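/- Let $p$ be a prime, let $d\ge 2$ and $c\ge 2$ be integers, and let $F$ be a free group of rank $d$. For a group $G$ let $\gamma_1(G)=G$, $\gamma_{n+1}(G)=[\gamma_n(G),G]$ be the lower central series, let $Z_0(G)=1$, $Z_{n+1}(G)/Z_n(G)=Z(G/Z_n(G))$ be the upper central series, let $H^{m}$ denote, for $H\le G$ and $m\ge 1$, the subgroup generated by all $m$-th powers of elements of $H$, and put $$\lambda_n(G)=\gamma_1(G)^{p^{n-1}}\,\gamma_2(G)^{p^{n-2}}\cdots\gamma_n(G)\qquad(n\ge 1).$$ Let $G_d^c=F/\lambda_{c+1}(F)$ be the disposition group. Then the upper central series of $G_d^c$ is given by $$Z_i(G_d^c)=\lambda_{c-i+1}(G_d^c)\qquad\text{for all } 0\le i\le c,$$ that is, $$1=Z_0(G_d^c)\subseteq Z(G_d^c)=\lambda_c(G_d^c)\subseteq\cdots\subseteq Z_i(G_d^c)=\lambda_{c-i+1}(G_d^c)\subseteq\cdots\subseteq Z_c(G_d^c)=\lambda_1(G_d^c)=G_d^c .$$ -/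

import Mathlib

/-- The `n`-th term `γ_n(G)` of the lower central series, in the numbering `γ_1(G) = G` and
`γ_{n+1}(G) = [γ_n(G), G]`. Only indices `n ≥ 1` are meaningful. -/
def gammaSeries (G : Type*) [Group G] (n : ℕ) : Subgroup G :=
  (⊤ : Subgroup G).lowerCentralSeries (n - 1)

theorem gammaSeries_one (G : Type*) [Group G] : gammaSeries G 1 = ⊤ := rfl

theorem gammaSeries_succ (G : Type*) [Group G] {n : ℕ} (hn : 1 ≤ n) :
    gammaSeries G (n + 1) = ⁅gammaSeries G n, (⊤ : Subgroup G)⁆ := by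
  obtain ⟨k, rfl⟩ : ∃ k, n = k + 1 := ⟨n - 1, by omega⟩
  rfl

instance gammaSeries_normal (G : Type*) [Group G] (n : ℕ) : (gammaSeries G n).Normal := by
  unfold gammaSeries
  infer_instance

/-- `H^m`, the subgroup generated by the `m`-th powers of the elements of `H`. -/
def powSubgroup {G : Type*} [Group G] (H : Subgroup G) (m : ℕ) : Subgroup G :=
  Subgroup.closure {x : G | ∃ h ∈ H, x = h ^ m}

instance powSubgroup_normal {G : Type*} [Group G] (H : Subgroup G) [hH : H.Normal] (m : ℕ) :
    (powSubgroup H m).Normal := by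
  have key : ∀ x ∈ powSubgroup H m, ∀ g : G, g * x * g⁻¹ ∈ powSubgroup H m := by
    intro x hx g
    have hle : powSubgroup H m ≤ (powSubgroup H m).comap (MulAut.conj g).toMonoidHom := by
      conv_lhs => unfold powSubgroup
      rw [Subgroup.closure_le]
      rintro _ ⟨h, hh, rfl⟩
      refine Subgroup.subset_closure ⟨g * h * g⁻¹, hH.conj_mem h hh g, ?_⟩
      simp [conj_pow]
    simpa using hle hx
  exact ⟨key⟩

/-- `λ_n(G) = γ_1(G)^{p^{n-1}} γ_2(G)^{p^{n-2}} ⋯ γ_n(G)` for `n ≥ 1`. The factors are normal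
subgroups, so their product is their supremum in the lattice of subgroups. -/
def lambdaSeries (p : ℕ) (G : Type*) [Group G] (n : ℕ) : Subgroup G :=
  ⨆ i ∈ Finset.Icc 1 n, powSubgroup (gammaSeries G i) (p ^ (n - i))

instance lambdaSeries_normal (p : ℕ) (G : Type*) [Group G] (n : ℕ) :
    (lambdaSeries p G n).Normal := by
  unfold lambdaSeries
  infer_instance

/-- The disposition group `G_d^c = F / λ_{c+1}(F)`, where `F` is the free group of rank `d`. -/
abbrev DispositionGroup (p d c : ℕ) : Type :=
  FreeGroup (Fin d) ⧸ lambdaSeries p (FreeGroup (Fin d)) (c + 1)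

/-!
The proof replaces `λ_n` by the lower exponent-`p` central series `P_1 = G`,
`P_{n+1} = [P_n, G] P_n ^ p`, and shows that in a free group `F` of rank at least two an element
`g` with `[g, F] ≤ P_{n+1}` lies in `P_n` (`mem_lowerPSeries_iff_commutator_mem`). The upper
central series of `F ⧸ λ_{c+1}` is then read off step by step.

The group `F` acts on noncommutative formal power series over `ℤ`, a free generator `a` acting as
multiplication by `1 + a` (the Magnus embedding). Let `J` be the ideal generated by `p` and the
letters. If `g ∈ P_n`, then the series `f = g - 1` lies in `J ^ n`, and the point is the converse
statement that `g ∈ P_n` and `f ∈ J ^ (n + 1)` imply `g ∈ P_{n+1}`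
(`mem_lowerPSeries_succ_of_magnusSeries_mem`). Granting it, suppose that `g ∈ P_n` commutes with
every free generator modulo `P_{n+2}`. Then `f a ≡ a f` modulo `J ^ (n + 2)` for each letter `a`.
If `w` is a nonempty word and `a` differs from its first letter, then `w a` has the same
coefficient in `f a - a f` as `w` has in `f`. Hence `f ∈ J ^ (n + 1)`, and so `g ∈ P_{n+1}`.

The converse statement rests on Lyndon words, each bracketed along its standard factorization into
a commutator `c_w`.

* Straightening by the Jacobi identity (`commutator_lyndonCommutator_mem`) shows that the `c_w`
  with `|w| = n` generate `γ_n` modulo `γ_{n+1}`. Therefore the powers `c_w ^ p ^ (n - |w|)` with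
  `|w| ≤ n` generate `P_n` modulo `P_{n+1}` (`lowerPSeries_le_lyndonPowerSpan`). This also gives
  `P_n ≤ λ_n P_m` for all `m ≥ n`, hence `P_n = λ_n`, because `P_m ≤ λ_n` for large `m`
  (`lowerPSeries_eq_lambdaSeries`).
* The series of `c_w ^ N - 1` is `N w` plus terms that come after `w` in the order by length and
  then lexicographically (`hasLeadingTerm_magnusSeries_pow`). The generators above can therefore
  be eliminated one after the other (`mem_lowerPSeries_succ_of_mem_closure`).

Leading words also dispose of `p = 2`, where the component of `a ^ p - 1` of lowest degree with
respect to `J` is not just `p a` but `2 a + a ^ 2`.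
-/

open scoped commutatorElement

/-! ### Lyndon words -/

/-- Either `a` is a proper prefix of `b`, or the comparison `a < b` is decided at a letter, and
then survives any continuation of the two words. -/
theorem List.prefix_or_append_lt_append {α : Type*} [LinearOrder α] :
    ∀ {a b : List α}, a < b → (∃ t, t ≠ [] ∧ b = a ++ t) ∨ ∀ x y, a ++ x < b ++ y
  | [], b, h => Or.inl ⟨b, by rintro rfl; exact lt_irrefl _ h, rfl⟩
  | a :: l, [], h => by simp at h
  | a :: l, b :: l', h => by
    rcases List.cons_lt_cons_iff.1 h with h | ⟨rfl, h'⟩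
    · exact Or.inr fun x y => List.cons_lt_cons_iff.2 (Or.inl h)
    · rcases List.prefix_or_append_lt_append h' with ⟨t, ht, e⟩ | h'
      · exact Or.inl ⟨t, ht, by rw [e, List.cons_append]⟩
      · exact Or.inr fun x y => List.cons_lt_cons_iff.2 (Or.inr ⟨rfl, h' x y⟩)

theorem List.append_lt_append_of_lt_of_length_le {α : Type*} [LinearOrder α] {a b : List α}
    (h : a < b) (hl : b.length ≤ a.length) (x y : List α) : a ++ x < b ++ y := by
  rcases List.prefix_or_append_lt_append h with ⟨t, ht, rfl⟩ | h
  · have := List.length_pos_iff.2 ht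
    rw [List.length_append] at hl
    omega
  · exact h x y

theorem List.append_lt_append_iff_left {α : Type*} [LinearOrder α] (s : List α) {a b : List α} :
    s ++ a < s ++ b ↔ a < b := by
  induction s with
  | nil => rfl
  | cons c s ih => simp [ih]

theorem List.lt_append_of_ne_nil {α : Type*} [LinearOrder α] (s : List α) {a : List α}
    (ha : a ≠ []) : s < s ++ a := by
  obtain ⟨b, l, rfl⟩ := List.exists_cons_of_ne_nil ha
  simpa using (List.append_lt_append_iff_left s (a := []) (b := b :: l)).2 (List.nil_lt_cons b l)

/-- A nonempty word is Lyndon if it is lexicographically smaller than each of its proper nonempty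
suffixes. -/
def IsLyndon {α : Type*} [LinearOrder α] (w : List α) : Prop :=
  w ≠ [] ∧ ∀ u v, u ≠ [] → v ≠ [] → w = u ++ v → w < v

theorem isLyndon_singleton {α : Type*} [LinearOrder α] (a : α) : IsLyndon [a] := by
  refine ⟨by simp, fun u v hu hv h => ?_⟩
  have := congrArg List.length h
  have h1 := List.length_pos_iff.2 hu
  have h2 := List.length_pos_iff.2 hv
  simp at this
  omega

theorem IsLyndon.append_lt_right {α : Type*} [LinearOrder α] {u v : List α} (hu : u ≠ [])
    (hv : IsLyndon v) (h : u < v) : u ++ v < v := by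
  rcases List.prefix_or_append_lt_append h with ⟨t, ht, rfl⟩ | h
  · exact (List.append_lt_append_iff_left u).2 (hv.2 u t hu ht rfl)
  · simpa using h v []

/-- `v` is the lexicographically least proper nonempty suffix of `u ++ v`. For a Lyndon word
`u ++ v` this says that `(u, v)` is its standard factorization. -/
def IsStandardSplit {α : Type*} [LinearOrder α] (u v : List α) : Prop :=
  u ≠ [] ∧ v ≠ [] ∧ ∀ a b, a ≠ [] → b ≠ [] → u ++ v = a ++ b → v ≤ b

theorem exists_isStandardSplit {α : Type*} [LinearOrder α] {w : List α} (hw : 2 ≤ w.length) :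
    ∃ u v, w = u ++ v ∧ IsStandardSplit u v := by
  obtain ⟨k, hk, hmin⟩ := Finset.exists_min_image (Finset.Ioo 0 w.length) (fun k => w.drop k)
    ⟨1, by simp; omega⟩
  rw [Finset.mem_Ioo] at hk
  refine ⟨w.take k, w.drop k, (List.take_append_drop k w).symm, ?_, ?_, ?_⟩
  · rw [← List.length_pos_iff, List.length_take]; omega
  · rw [← List.length_pos_iff, List.length_drop]; omega
  · intro a b ha hb h
    rw [List.take_append_drop] at h
    have h1 := List.length_pos_iff.2 ha
    have h2 := List.length_pos_iff.2 hb
    have := hmin a.length (by rw [Finset.mem_Ioo, h, List.length_append]; omega)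
    simpa [h] using this

theorem IsStandardSplit.unique {α : Type*} [LinearOrder α] {u v u' v' : List α}
    (h : IsStandardSplit u v) (h' : IsStandardSplit u' v') (e : u ++ v = u' ++ v') :
    u = u' ∧ v = v' := by
  have hv : v = v' := le_antisymm (h.2.2 u' v' h'.1 h'.2.1 e) (h'.2.2 u v h.1 h.2.1 e.symm)
  subst hv
  exact ⟨List.append_cancel_right e, rfl⟩

theorem IsStandardSplit.isLyndon_right {α : Type*} [LinearOrder α] {u v : List α}
    (h : IsStandardSplit u v) : IsLyndon v := by
  refine ⟨h.2.1, fun a b ha hb e => lt_of_le_of_ne ?_ ?_⟩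
  · exact h.2.2 (u ++ a) b (by simp [ha]) hb (by simp [e])
  · rintro rfl
    have := List.length_pos_iff.2 ha
    have := congrArg List.length e
    rw [List.length_append] at this
    omega

theorem IsStandardSplit.isLyndon_left {α : Type*} [LinearOrder α] {u v : List α}
    (h : IsStandardSplit u v) (hw : IsLyndon (u ++ v)) : IsLyndon u := by
  refine ⟨h.1, fun a s ha hs e => ?_⟩
  by_contra hlt
  have hne : s ≠ u := by
    rintro rfl
    have := List.length_pos_iff.2 ha
    have := congrArg List.length e
    rw [List.length_append] at this
    omega
  have hsu : s < u := lt_of_le_of_ne (not_lt.1 hlt) hne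
  have hw' : u ++ v < s ++ v := hw.2 a (s ++ v) ha (by simp [hs]) (by simp [e])
  -- If the comparison `s < u` is decided at a letter, it contradicts `u ++ v < s ++ v`;
  -- otherwise `u = s ++ t` and the suffix `t ++ v` is smaller than `v`.
  rcases List.prefix_or_append_lt_append hsu with ⟨t, ht, hut⟩ | h'
  · rw [hut, List.append_assoc, List.append_lt_append_iff_left] at hw'
    exact absurd (h.2.2 s (t ++ v) hs (by simp [ht]) (by simp [hut])) (not_le.2 hw')
  · exact lt_asymm hw' (h' v v)

/-- The pair `(u, v)` is a standard split as soon as no proper suffix of `u` is smaller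
than `v`. -/
theorem isStandardSplit_of_forall_le {α : Type*} [LinearOrder α] {u v : List α} (hu : u ≠ [])
    (hv : IsLyndon v) (h : ∀ a s, a ≠ [] → s ≠ [] → u = a ++ s → v ≤ s) :
    IsStandardSplit u v := by
  refine ⟨hu, hv.1, fun a b ha hb e => ?_⟩
  rcases List.append_eq_append_iff.1 e with ⟨t, rfl, rfl⟩ | ⟨t, rfl, rfl⟩
  · rcases eq_or_ne t [] with rfl | ht
    · simp
    · exact (hv.2 t b ht hb rfl).le
  · rcases eq_or_ne t [] with rfl | ht
    · simp
    · exact (h a t ha ht rfl).trans (List.lt_append_of_ne_nil t hv.1).le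

theorem IsLyndon.append {α : Type*} [LinearOrder α] {u v : List α} (hu : IsLyndon u)
    (hv : IsLyndon v) (h : u < v) : IsLyndon (u ++ v) := by
  have huv : u ++ v < v := hv.append_lt_right hu.1 h
  refine ⟨by simp [hu.1], fun a b ha hb e => ?_⟩
  rcases List.append_eq_append_iff.1 e with ⟨t, rfl, rfl⟩ | ⟨t, rfl, rfl⟩
  · rcases eq_or_ne t [] with rfl | ht
    · simpa using huv
    · exact huv.trans (hv.2 t b ht hb rfl)
  · rcases eq_or_ne t [] with rfl | ht
    · simpa using huv
    · exact List.append_lt_append_of_lt_of_length_le (hu.2 a t ha ht rfl) (by simp) _ _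

theorem IsLyndon.append_lt_append_swap {α : Type*} [LinearOrder α] {u v : List α}
    (hu : u ≠ []) (hv : v ≠ []) (h : IsLyndon (u ++ v)) : u ++ v < v ++ u :=
  (h.2 u v hu hv rfl).trans (List.lt_append_of_ne_nil v hu)

/-! ### Commutators of Lyndon words span the lower central quotients -/


section CommutatorCalculus

variable {G : Type*} [Group G]

/-- The subgroup of elements that commute with `a` modulo the normal subgroup `K`. -/
def centralizerMod (K : Subgroup G) [K.Normal] (a : G) : Subgroup G :=
  (Subgroup.centralizer {(a : G ⧸ K)}).comap (QuotientGroup.mk' K)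

theorem commutator_mem_iff_commute (K : Subgroup G) [K.Normal] {a b : G} :
    ⁅a, b⁆ ∈ K ↔ Commute (a : G ⧸ K) (b : G ⧸ K) := by
  rw [← commutatorElement_eq_one_iff_commute, ← QuotientGroup.eq_one_iff]
  rfl

theorem mem_centralizerMod {K : Subgroup G} [K.Normal] {a x : G} :
    x ∈ centralizerMod K a ↔ ⁅x, a⁆ ∈ K := by
  rw [commutator_mem_iff_commute, centralizerMod, Subgroup.mem_comap,
    Subgroup.mem_centralizer_singleton_iff]
  rfl

theorem commutator_mem_comm {K : Subgroup G} {a b : G} : ⁅a, b⁆ ∈ K ↔ ⁅b, a⁆ ∈ K := by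
  rw [← commutatorElement_inv, inv_mem_iff]

theorem Subgroup.normal_of_commutator_le {A K : Subgroup G} (hK : K ≤ A)
    (h : ⁅A, (⊤ : Subgroup G)⁆ ≤ K) : K.Normal := by
  refine ⟨fun k hk g => ?_⟩
  have h1 : ⁅g, k⁆ ∈ K :=
    commutator_mem_comm.1 (h (Subgroup.commutator_mem_commutator (hK hk) (Subgroup.mem_top g)))
  have h2 := mul_mem h1 hk
  simpa [commutatorElement_def] using h2

/-- The Jacobi identity for commutators, modulo a normal subgroup containing the commutators of
higher weight. It is a form of the Hall–Witt identity. -/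
theorem commutator_commutator_mem (K : Subgroup G) [K.Normal] {a b c : G}
    (h₁ : ⁅⁅b, c⁆, a⁆ ∈ K) (h₂ : ⁅⁅c, a⁆, b⁆ ∈ K) (h₃ : ⁅⁅a, b⁆, ⁅b, c⁆⁆ ∈ K)
    (h₄ : ⁅⁅b, c⁆, ⁅c, a⁆⁆ ∈ K) (h₅ : ⁅⁅c, a⁆, ⁅a, b⁆⁆ ∈ K) : ⁅⁅a, b⁆, c⁆ ∈ K := by
  rw [commutator_mem_iff_commute] at *
  have q : ∀ x y : G, ((⁅x, y⁆ : G) : G ⧸ K) = ⁅(x : G ⧸ K), (y : G ⧸ K)⁆ := fun _ _ => rfl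
  simp only [q] at *
  generalize (a : G ⧸ K) = a at *
  generalize (b : G ⧸ K) = b at *
  generalize (c : G ⧸ K) = c at *
  have e : ∀ x y : G ⧸ K, x * y * x⁻¹ = ⁅x, y⁆ * y := fun x y => by simp [commutatorElement_def]
  have k₁ : ⁅⁅b, c⁆, c * a * c⁻¹⁆ = 1 :=
    (by rw [e]; exact h₄.mul_right h₁ : Commute _ _).commutator_eq
  have k₂ : ⁅⁅c, a⁆, a * b * a⁻¹⁆ = 1 :=
    (by rw [e]; exact h₅.mul_right h₂ : Commute _ _).commutator_eq
  have hallWitt : ⁅⁅a, b⁆, b * c * b⁻¹⁆ * ⁅⁅b, c⁆, c * a * c⁻¹⁆ * ⁅⁅c, a⁆, a * b * a⁻¹⁆ = 1 := by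
    simp only [commutatorElement_def]
    group
  rw [k₁, k₂, mul_one, mul_one, commutatorElement_eq_one_iff_commute, e] at hallWitt
  have := h₃.inv_right.mul_right hallWitt
  rwa [inv_mul_cancel_left] at this

theorem gammaSeries_antitone : Antitone (gammaSeries G) := fun m n h =>
  (⊤ : Subgroup G).lowerCentralSeries_antitone (show m - 1 ≤ n - 1 by omega)

/-- The three subgroups lemma, modulo a normal subgroup. -/
theorem commutator_commutator_le_of_rotate {A B C K : Subgroup G} [K.Normal]
    (h₁ : ⁅⁅B, C⁆, A⁆ ≤ K) (h₂ : ⁅⁅C, A⁆, B⁆ ≤ K) : ⁅⁅A, B⁆, C⁆ ≤ K := by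
  have key : ∀ {X Y Z : Subgroup G}, ⁅⁅X, Y⁆, Z⁆ ≤ K ↔
      ⁅⁅X.map (QuotientGroup.mk' K), Y.map (QuotientGroup.mk' K)⁆,
        Z.map (QuotientGroup.mk' K)⁆ = ⊥ := by
    intro X Y Z
    rw [← Subgroup.map_commutator, ← Subgroup.map_commutator, Subgroup.map_eq_bot_iff,
      QuotientGroup.ker_mk']
  rw [key] at *
  exact Subgroup.commutator_commutator_eq_bot_of_rotate h₁ h₂

theorem commutator_gammaSeries_le {i j : ℕ} (hi : 1 ≤ i) (hj : 1 ≤ j) :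
    ⁅gammaSeries G i, gammaSeries G j⁆ ≤ gammaSeries G (i + j) := by
  induction j, hj using Nat.le_induction generalizing i with
  | base => rw [gammaSeries_succ G hi, gammaSeries_one]
  | succ j hj ih =>
    rw [gammaSeries_succ G hj, Subgroup.commutator_comm]
    refine commutator_commutator_le_of_rotate ?_ ?_
    · rw [Subgroup.commutator_comm ⊤, ← gammaSeries_succ G hi]
      exact (ih (by omega)).trans (gammaSeries_antitone (by omega))
    · rw [← add_assoc, gammaSeries_succ G (by omega)]
      exact Subgroup.commutator_mono (ih hi) le_rfl

theorem commutator_mem_gammaSeries {i j n : ℕ} {a b : G} (ha : a ∈ gammaSeries G i)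
    (hb : b ∈ gammaSeries G j) (hi : 1 ≤ i) (hj : 1 ≤ j) (h : n ≤ i + j) :
    ⁅a, b⁆ ∈ gammaSeries G n :=
  gammaSeries_antitone h
    (commutator_gammaSeries_le hi hj (Subgroup.commutator_mem_commutator ha hb))

end CommutatorCalculus

section LyndonCommutators

variable {α : Type*} [LinearOrder α] {G : Type*} [Group G] (x : α → G)

/-- The commutator attached to a word by bracketing it, recursively, along its standard
factorization, after substituting `x a` for the letter `a`. The empty word is given the junk
value `1`. -/
noncomputable def lyndonCommutator : List α → G
  | [] => 1
  | [a] => x a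
  | a :: b :: l =>
    have h := exists_isStandardSplit (w := a :: b :: l) (by simp)
    ⁅lyndonCommutator h.choose, lyndonCommutator h.choose_spec.choose⁆
termination_by w => w.length
decreasing_by
  all_goals
    have h := exists_isStandardSplit (w := a :: b :: l) (by simp)
    have h1 := congrArg List.length h.choose_spec.choose_spec.1
    have h2 := List.length_pos_iff.2 h.choose_spec.choose_spec.2.1
    have h3 := List.length_pos_iff.2 h.choose_spec.choose_spec.2.2.1
    rw [List.length_append] at h1
    omega

theorem lyndonCommutator_singleton (a : α) : lyndonCommutator x [a] = x a := by
  rw [lyndonCommutator]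

theorem lyndonCommutator_append {u v : List α} (h : IsStandardSplit u v) :
    lyndonCommutator x (u ++ v) = ⁅lyndonCommutator x u, lyndonCommutator x v⁆ := by
  obtain ⟨a, l, rfl⟩ := List.exists_cons_of_ne_nil h.1
  obtain ⟨b, l', e⟩ : ∃ b l', l ++ v = b :: l' := List.exists_cons_of_ne_nil (by simp [h.2.1])
  have hs := (exists_isStandardSplit (w := a :: b :: l') (by simp)).choose_spec.choose_spec
  obtain ⟨h1, h2⟩ := h.unique hs.2 (by rw [← hs.1, List.cons_append, e])
  rw [List.cons_append, e, lyndonCommutator]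
  exact congrArg₂ (fun s t => ⁅lyndonCommutator x s, lyndonCommutator x t⁆) h1.symm h2.symm

/-- Induction along standard factorizations. -/
theorem IsLyndon.induction {motive : List α → Prop} {w : List α} (hw : IsLyndon w)
    (singleton : ∀ a, motive [a])
    (append : ∀ u v, IsStandardSplit u v → IsLyndon u → IsLyndon v → IsLyndon (u ++ v) →
      motive u → motive v → motive (u ++ v)) : motive w := by
  induction hn : w.length using Nat.strong_induction_on generalizing w with
  | _ n ih =>
    have hpos := List.length_pos_iff.2 hw.1
    by_cases h : w.length = 1
    · obtain ⟨a, rfl⟩ := List.length_eq_one_iff.1 h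
      exact singleton a
    · obtain ⟨u, v, rfl, hs⟩ := exists_isStandardSplit (w := w) (by omega)
      have h1 := List.length_pos_iff.2 hs.1
      have h2 := List.length_pos_iff.2 hs.2.1
      rw [List.length_append] at hn
      have hu := hs.isLyndon_left hw
      have hv := hs.isLyndon_right
      exact append u v hs hu hv hw (ih _ (by omega) hu rfl) (ih _ (by omega) hv rfl)

theorem lyndonCommutator_mem_gammaSeries {w : List α} (hw : IsLyndon w) :
    lyndonCommutator x w ∈ gammaSeries G w.length := by
  refine hw.induction (motive := fun w => lyndonCommutator x w ∈ gammaSeries G w.length)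
    (fun a => Subgroup.mem_top _) fun u v hs hu hv hw ihu ihv => ?_
  rw [lyndonCommutator_append x hs]
  exact commutator_mem_gammaSeries ihu ihv (List.length_pos_iff.2 hs.1)
    (List.length_pos_iff.2 hs.2.1) (by simp)

/-- The subgroup generated, modulo commutators of weight above `n`, by the commutators of the
Lyndon words of length `n` that are lexicographically smaller than `m`. -/
def lyndonSpanBelow (n : ℕ) (m : List α) : Subgroup G :=
  Subgroup.closure {g | ∃ w, IsLyndon w ∧ w.length = n ∧ w < m ∧ lyndonCommutator x w = g} ⊔
    gammaSeries G (n + 1)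

/-- The subgroup generated, modulo commutators of weight above `n`, by the commutators of the
Lyndon words of length `n`. -/
def lyndonSpan (n : ℕ) : Subgroup G :=
  Subgroup.closure {g | ∃ w, IsLyndon w ∧ w.length = n ∧ lyndonCommutator x w = g} ⊔
    gammaSeries G (n + 1)

theorem lyndonSpanBelow_mono {n : ℕ} {m m' : List α} (h : m ≤ m') :
    lyndonSpanBelow x n m ≤ lyndonSpanBelow x n m' := by
  refine sup_le_sup_right (Subgroup.closure_mono ?_) _
  rintro _ ⟨w, hw, hl, hlt, rfl⟩
  exact ⟨w, hw, hl, hlt.trans_le h, rfl⟩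

theorem lyndonSpanBelow_le_lyndonSpan (n : ℕ) (m : List α) :
    lyndonSpanBelow x n m ≤ lyndonSpan x n := by
  refine sup_le_sup_right (Subgroup.closure_mono ?_) _
  rintro _ ⟨w, hw, hl, -, rfl⟩
  exact ⟨w, hw, hl, rfl⟩

theorem lyndonSpan_le_gammaSeries (n : ℕ) : lyndonSpan x n ≤ gammaSeries G n := by
  refine sup_le ((Subgroup.closure_le _).2 ?_) (gammaSeries_antitone n.le_succ)
  rintro _ ⟨w, hw, rfl, rfl⟩
  exact lyndonCommutator_mem_gammaSeries x hw

theorem lyndonSpanBelow_normal {n : ℕ} (hn : 1 ≤ n) (m : List α) :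
    (lyndonSpanBelow x n m).Normal :=
  Subgroup.normal_of_commutator_le
    ((lyndonSpanBelow_le_lyndonSpan x n m).trans (lyndonSpan_le_gammaSeries x n))
    ((gammaSeries_succ G hn).ge.trans le_sup_right)

theorem lyndonSpan_normal {n : ℕ} (hn : 1 ≤ n) : (lyndonSpan x n).Normal :=
  Subgroup.normal_of_commutator_le (lyndonSpan_le_gammaSeries x n)
    ((gammaSeries_succ G hn).ge.trans le_sup_right)

/-- The straightening rule for Lyndon words: the commutator of two Lyndon commutators is, modulo
higher weight, a product of Lyndon commutators, all of them smaller than the larger of the two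
words. If `(u, v)` is not a standard factorization, then `u` has a standard factorization
`(u', u'')` with `u'' < v`, and the Jacobi identity replaces the pair by pairs of the same total
length lying below `v`. -/
theorem commutator_lyndonCommutator_mem [Finite α] (n : ℕ) :
    ∀ v u : List α, IsLyndon u → IsLyndon v → u.length + v.length = n → u < v →
      ⁅lyndonCommutator x u, lyndonCommutator x v⁆ ∈ lyndonSpanBelow x n v := by
  induction n using Nat.strong_induction_on with
  | _ n ihn =>
  intro v
  by_cases hvn : v.length ≤ n
  swap
  · intro u hu hv h
    omega
  have hwf : {w : List α | w.length ≤ n}.WellFoundedOn (· < ·) :=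
    (List.finite_length_le α n).wellFoundedOn
  refine hwf.induction (P := fun v => ∀ u : List α, IsLyndon u → IsLyndon v →
    u.length + v.length = n → u < v →
      ⁅lyndonCommutator x u, lyndonCommutator x v⁆ ∈ lyndonSpanBelow x n v) hvn ?_
  clear hvn v
  intro v hvn ihv u hu hv hlen huv
  have hu0 := List.length_pos_iff.2 hu.1
  have hv0 := List.length_pos_iff.2 hv.1
  have : (lyndonSpanBelow x n v).Normal := lyndonSpanBelow_normal x (by omega) v
  -- The inductive hypothesis, for an unordered pair of words below `v`.
  have below : ∀ s t : List α, IsLyndon s → IsLyndon t → s.length + t.length = n → s < v →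
      t < v → ⁅lyndonCommutator x s, lyndonCommutator x t⁆ ∈ lyndonSpanBelow x n v := by
    intro s t hs ht hst hsv htv
    rcases lt_trichotomy s t with h | rfl | h
    · exact lyndonSpanBelow_mono x htv.le
        (ihv t (show t.length ≤ n by omega) htv s hs ht hst h)
    · rw [commutatorElement_self]
      exact one_mem _
    · rw [commutator_mem_comm]
      exact lyndonSpanBelow_mono x hsv.le
        (ihv s (show s.length ≤ n by omega) hsv t ht hs (by omega) h)
  -- The same for an element of the span in place of the first word.
  have spanBelow : ∀ (k : ℕ) (t : List α) (y : G), 1 ≤ k → y ∈ lyndonSpanBelow x k v →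
      IsLyndon t → k + t.length = n → t < v →
        ⁅y, lyndonCommutator x t⁆ ∈ lyndonSpanBelow x n v := by
    intro k t y hk hy ht hkt htv
    have ht0 := List.length_pos_iff.2 ht.1
    have : lyndonSpanBelow x k v ≤
        centralizerMod (lyndonSpanBelow x n v) (lyndonCommutator x t) := by
      refine sup_le ((Subgroup.closure_le _).2 ?_) ?_
      · rintro _ ⟨w, hw, hwk, hwv, rfl⟩
        exact mem_centralizerMod.2 (below w t hw ht (by omega) hwv htv)
      · intro z hz
        refine mem_centralizerMod.2 (Subgroup.mem_sup_right ?_)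
        exact commutator_mem_gammaSeries hz (lyndonCommutator_mem_gammaSeries x ht) (by omega)
          ht0 (by omega)
    exact mem_centralizerMod.1 (this hy)
  by_cases hstd : IsStandardSplit u v
  · rw [← lyndonCommutator_append x hstd]
    refine Subgroup.mem_sup_left (Subgroup.subset_closure ⟨u ++ v, hu.append hv huv, ?_, ?_, rfl⟩)
    · simpa using hlen
    · exact hv.append_lt_right hu.1 huv
  · have hu2 : 2 ≤ u.length := by
      by_contra hlt
      refine hstd (isStandardSplit_of_forall_le hu.1 hv fun a s ha hs e => ?_)
      have h1 := List.length_pos_iff.2 ha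
      have h2 := List.length_pos_iff.2 hs
      have := congrArg List.length e
      rw [List.length_append] at this
      omega
    obtain ⟨u', u'', rfl, hs⟩ := exists_isStandardSplit hu2
    have hlt : u'' < v := by
      by_contra hle
      exact hstd (isStandardSplit_of_forall_le hu.1 hv fun a s ha hs' e =>
        (not_lt.1 hle).trans (hs.2.2 a s ha hs' e))
    have hu' := hs.isLyndon_left hu
    have hu'' := hs.isLyndon_right
    have hlt' : u' < v := (List.lt_append_of_ne_nil u' hs.2.1).trans huv
    have h1 := List.length_pos_iff.2 hu'.1
    have h2 := List.length_pos_iff.2 hu''.1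
    rw [List.length_append] at hlen
    have ga := lyndonCommutator_mem_gammaSeries x hu'
    have gb := lyndonCommutator_mem_gammaSeries x hu''
    have gc := lyndonCommutator_mem_gammaSeries x hv
    have gab := commutator_mem_gammaSeries ga gb h1 h2 le_rfl
    have gbc := commutator_mem_gammaSeries gb gc h2 hv0 le_rfl
    have gca := commutator_mem_gammaSeries gc ga hv0 h1 le_rfl
    rw [lyndonCommutator_append x hs]
    refine commutator_commutator_mem _ ?_ ?_ ?_ ?_ ?_
    · exact spanBelow _ u' _ (by omega) (ihn (u''.length + v.length) (by omega) v u'' hu'' hv rfl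
        hlt) hu' (by omega) hlt'
    · exact spanBelow (u'.length + v.length) u'' _ (by omega) (commutator_mem_comm.1
        (ihn (u'.length + v.length) (by omega) v u' hu' hv rfl hlt')) hu'' (by omega) hlt
    · exact Subgroup.mem_sup_right
        (commutator_mem_gammaSeries gab gbc (by omega) (by omega) (by omega))
    · exact Subgroup.mem_sup_right
        (commutator_mem_gammaSeries gbc gca (by omega) (by omega) (by omega))
    · exact Subgroup.mem_sup_right
        (commutator_mem_gammaSeries gca gab (by omega) (by omega) (by omega))

theorem commutator_lyndonCommutator_mem_lyndonSpan [Finite α] {u v : List α} (hu : IsLyndon u)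
    (hv : IsLyndon v) :
    ⁅lyndonCommutator x u, lyndonCommutator x v⁆ ∈ lyndonSpan x (u.length + v.length) := by
  rcases lt_trichotomy u v with h | rfl | h
  · exact lyndonSpanBelow_le_lyndonSpan x _ v
      (commutator_lyndonCommutator_mem x _ v u hu hv rfl h)
  · rw [commutatorElement_self]
    exact one_mem _
  · rw [commutator_mem_comm]
    exact lyndonSpanBelow_le_lyndonSpan x _ u
      (commutator_lyndonCommutator_mem x _ u v hv hu (add_comm _ _) h)

/-- In a group generated by the `x a`, the commutators of the Lyndon words of length `n` generate
`γ_n` modulo `γ_{n+1}`. -/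
theorem gammaSeries_le_lyndonSpan [Finite α] (hx : Subgroup.closure (Set.range x) = ⊤) {n : ℕ}
    (hn : 1 ≤ n) : gammaSeries G n ≤ lyndonSpan x n := by
  induction n, hn using Nat.le_induction with
  | base =>
    rw [gammaSeries_one, ← hx, Subgroup.closure_le]
    rintro _ ⟨a, rfl⟩
    exact Subgroup.mem_sup_left (Subgroup.subset_closure
      ⟨[a], isLyndon_singleton a, rfl, lyndonCommutator_singleton x a⟩)
  | succ n hn ih =>
    have := lyndonSpan_normal x (n := n + 1) (by omega)
    rw [gammaSeries_succ G hn, Subgroup.commutator_le]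
    intro y hy h _
    suffices lyndonSpan x n ≤ centralizerMod (lyndonSpan x (n + 1)) h from
      mem_centralizerMod.1 (this (ih hy))
    have hh : h ∈ gammaSeries G 1 := Subgroup.mem_top h
    refine sup_le ((Subgroup.closure_le _).2 ?_) fun z hz => mem_centralizerMod.2
      (Subgroup.mem_sup_right (commutator_mem_gammaSeries hz hh (by omega) le_rfl le_rfl))
    rintro _ ⟨w, hw, rfl, rfl⟩
    have : Subgroup.closure (Set.range x) ≤
        centralizerMod (lyndonSpan x (w.length + 1)) (lyndonCommutator x w) := by
      rw [Subgroup.closure_le]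
      rintro _ ⟨a, rfl⟩
      refine mem_centralizerMod.2 (commutator_mem_comm.1 ?_)
      have := commutator_lyndonCommutator_mem_lyndonSpan x hw (isLyndon_singleton a)
      rwa [lyndonCommutator_singleton] at this
    rw [hx] at this
    exact mem_centralizerMod.2 (commutator_mem_comm.1
      (mem_centralizerMod.1 (this (Subgroup.mem_top h))))

end LyndonCommutators

/-! ### The lower exponent-`p` central series -/

section LowerPSeries

/-- The lower exponent-`p` central series `P_1 = G`, `P_{n+1} = [P_n, G] P_n ^ p`. The index `0`
carries the junk value `G`. -/
def lowerPSeries (p : ℕ) (G : Type*) [Group G] : ℕ → Subgroup G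
  | 0 => ⊤
  | 1 => ⊤
  | n + 2 => ⁅lowerPSeries p G (n + 1), ⊤⁆ ⊔ powSubgroup (lowerPSeries p G (n + 1)) p

variable {p : ℕ} {G : Type*} [Group G]

theorem pow_mem_powSubgroup {H : Subgroup G} {h : G} (hh : h ∈ H) (m : ℕ) :
    h ^ m ∈ powSubgroup H m :=
  Subgroup.subset_closure ⟨h, hh, rfl⟩

theorem powSubgroup_le {H K : Subgroup G} {m : ℕ} (h : ∀ a ∈ H, a ^ m ∈ K) :
    powSubgroup H m ≤ K := by
  refine (Subgroup.closure_le K).2 ?_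
  rintro _ ⟨a, ha, rfl⟩
  exact h a ha

theorem lowerPSeries_succ {n : ℕ} (hn : 1 ≤ n) : lowerPSeries p G (n + 1) =
    ⁅lowerPSeries p G n, (⊤ : Subgroup G)⁆ ⊔ powSubgroup (lowerPSeries p G n) p := by
  obtain ⟨k, rfl⟩ : ∃ k, n = k + 1 := ⟨n - 1, by omega⟩
  rw [lowerPSeries]

theorem lowerPSeries_one : lowerPSeries p G 1 = ⊤ := rfl

instance lowerPSeries_normal (n : ℕ) : (lowerPSeries p G n).Normal := by
  induction n with
  | zero => exact inferInstanceAs (⊤ : Subgroup G).Normal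
  | succ n ih =>
    rcases n with _ | n
    · exact inferInstanceAs (⊤ : Subgroup G).Normal
    · rw [lowerPSeries_succ (by omega)]
      infer_instance

theorem commutator_mem_lowerPSeries {n : ℕ} (hn : 1 ≤ n) {a : G} (ha : a ∈ lowerPSeries p G n)
    (g : G) : ⁅a, g⁆ ∈ lowerPSeries p G (n + 1) := by
  rw [lowerPSeries_succ hn]
  exact Subgroup.mem_sup_left (Subgroup.commutator_mem_commutator ha (Subgroup.mem_top g))

theorem commutator_lowerPSeries_le {n : ℕ} (hn : 1 ≤ n) :
    ⁅lowerPSeries p G n, (⊤ : Subgroup G)⁆ ≤ lowerPSeries p G (n + 1) :=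
  Subgroup.commutator_le.2 fun _ ha g _ => commutator_mem_lowerPSeries hn ha g

theorem pow_mem_lowerPSeries {n : ℕ} (hn : 1 ≤ n) {a : G} (ha : a ∈ lowerPSeries p G n) :
    a ^ p ∈ lowerPSeries p G (n + 1) := by
  rw [lowerPSeries_succ hn]
  exact Subgroup.mem_sup_right (pow_mem_powSubgroup ha p)

theorem pow_pow_mem_lowerPSeries {n : ℕ} (hn : 1 ≤ n) {a : G} (ha : a ∈ lowerPSeries p G n)
    (k : ℕ) : a ^ p ^ k ∈ lowerPSeries p G (n + k) := by
  induction k with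
  | zero => simpa using ha
  | succ k ih =>
    rw [pow_succ, pow_mul]
    exact pow_mem_lowerPSeries (n := n + k) (by omega) ih

theorem lowerPSeries_antitone : Antitone (lowerPSeries p G) := by
  refine antitone_nat_of_succ_le fun n => ?_
  rcases n with _ | n
  · exact le_top
  · rw [lowerPSeries_succ (n := n + 1) (by omega)]
    exact sup_le (Subgroup.commutator_le_left _ _) (powSubgroup_le fun a ha => pow_mem ha p)

theorem gammaSeries_le_lowerPSeries {n : ℕ} (hn : 1 ≤ n) :
    gammaSeries G n ≤ lowerPSeries p G n := by
  induction n, hn using Nat.le_induction with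
  | base => exact le_top
  | succ n hn ih =>
    rw [gammaSeries_succ G hn]
    exact (Subgroup.commutator_mono ih le_rfl).trans (commutator_lowerPSeries_le hn)

theorem commutator_lowerPSeries_two_le {n : ℕ} (hn : 1 ≤ n) :
    ⁅lowerPSeries p G n, lowerPSeries p G 2⁆ ≤ lowerPSeries p G (n + 2) := by
  rw [Subgroup.commutator_comm]
  have h₁ : ⁅⁅(⊤ : Subgroup G), (⊤ : Subgroup G)⁆, lowerPSeries p G n⁆ ≤
      lowerPSeries p G (n + 2) := by
    have h : ⁅⁅lowerPSeries p G n, (⊤ : Subgroup G)⁆, (⊤ : Subgroup G)⁆ ≤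
        lowerPSeries p G (n + 2) :=
      (Subgroup.commutator_mono (commutator_lowerPSeries_le hn) le_rfl).trans
        (commutator_lowerPSeries_le (by omega))
    refine commutator_commutator_le_of_rotate ?_ h
    rwa [Subgroup.commutator_comm (⊤ : Subgroup G)]
  refine Subgroup.commutator_le.2 fun g hg a ha => ?_
  rw [← mem_centralizerMod]
  refine (sup_le ?_ (powSubgroup_le ?_) :
    ⁅(⊤ : Subgroup G), ⊤⁆ ⊔ powSubgroup ⊤ p ≤ _) hg
  · exact fun c hc => mem_centralizerMod.2 (h₁ (Subgroup.commutator_mem_commutator hc ha))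
  · -- Modulo `P_{n+2}` the commutator `[x, a] ∈ P_{n+1}` is central and has trivial `p`-th power.
    intro x _
    rw [mem_centralizerMod, commutator_mem_iff_commute]
    set q := QuotientGroup.mk' (lowerPSeries p G (n + 2))
    have hxa : ⁅x, a⁆ ∈ lowerPSeries p G (n + 1) :=
      commutator_mem_comm.1 (commutator_mem_lowerPSeries hn ha x)
    have hcomm : Commute (q ⁅x, a⁆) (q x) :=
      (commutator_mem_iff_commute _).1 (commutator_mem_lowerPSeries (by omega) hxa x)
    have hpow : q ⁅x, a⁆ ^ p = 1 := by
      rw [← map_pow]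
      exact (QuotientGroup.eq_one_iff _).2 (pow_mem_lowerPSeries (by omega) hxa)
    change Commute (q (x ^ p)) (q a)
    have hconj : q a * q x * (q a)⁻¹ = (q ⁅x, a⁆)⁻¹ * q x := by
      simp [commutatorElement_def, mul_assoc]
    have : q a * q (x ^ p) * (q a)⁻¹ = q (x ^ p) := by
      rw [map_pow, ← conj_pow, hconj, hcomm.inv_left.mul_pow, inv_pow, hpow, inv_one, one_mul]
    exact (mul_inv_eq_iff_eq_mul.1 this).symm

/-- The elements of `A` whose `p`-th power lies in `K`, when `A` is abelian modulo `K`. -/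
def powPreimage (A K : Subgroup G) [K.Normal] (p : ℕ) (h : ⁅A, A⁆ ≤ K) : Subgroup G where
  carrier := {a | a ∈ A ∧ a ^ p ∈ K}
  one_mem' := ⟨one_mem A, by simp⟩
  inv_mem' := fun ⟨ha, ha'⟩ => ⟨inv_mem ha, by simpa using ha'⟩
  mul_mem' := by
    rintro a b ⟨ha, ha'⟩ ⟨hb, hb'⟩
    refine ⟨mul_mem ha hb, ?_⟩
    have hab : Commute (a : G ⧸ K) b :=
      (commutator_mem_iff_commute K).1 (h (Subgroup.commutator_mem_commutator ha hb))
    rw [← QuotientGroup.eq_one_iff, QuotientGroup.mk_pow] at ha' hb' ⊢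
    rw [QuotientGroup.mk_mul, hab.mul_pow, ha', hb', one_mul]

theorem mem_powPreimage {A K : Subgroup G} [K.Normal] {h : ⁅A, A⁆ ≤ K} {a : G} :
    a ∈ powPreimage A K p h ↔ a ∈ A ∧ a ^ p ∈ K :=
  Iff.rfl

variable {α : Type*} [LinearOrder α] (x : α → G)

/-- The subgroup generated, modulo `P_{n+1}`, by the powers `c_w ^ p ^ (n - |w|)`, where `c_w` is
the commutator of a Lyndon word `w` of length at most `n`. -/
def lyndonPowerSpan (p : ℕ) (n : ℕ) : Subgroup G :=
  Subgroup.closure {g | ∃ w, IsLyndon w ∧ w.length ≤ n ∧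
    lyndonCommutator x w ^ p ^ (n - w.length) = g} ⊔ lowerPSeries p G (n + 1)

theorem IsLyndon.one_le_length {w : List α} (hw : IsLyndon w) : 1 ≤ w.length :=
  List.length_pos_iff.2 hw.1

theorem lyndonCommutator_pow_mem_lowerPSeries {w : List α} (hw : IsLyndon w) {n : ℕ}
    (hn : w.length ≤ n) :
    lyndonCommutator x w ^ p ^ (n - w.length) ∈ lowerPSeries p G n := by
  have := pow_pow_mem_lowerPSeries (p := p) hw.one_le_length
    (gammaSeries_le_lowerPSeries hw.one_le_length (lyndonCommutator_mem_gammaSeries x hw))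
    (n - w.length)
  rwa [Nat.add_sub_cancel' hn] at this

theorem lyndonPowerSpan_le_lowerPSeries (n : ℕ) :
    lyndonPowerSpan x p n ≤ lowerPSeries p G n := by
  refine sup_le ((Subgroup.closure_le _).2 ?_) (lowerPSeries_antitone n.le_succ)
  rintro _ ⟨w, hw, hn, rfl⟩
  exact lyndonCommutator_pow_mem_lowerPSeries x hw hn

theorem lyndonPowerSpan_normal {n : ℕ} (hn : 1 ≤ n) : (lyndonPowerSpan x p n).Normal :=
  Subgroup.normal_of_commutator_le (lyndonPowerSpan_le_lowerPSeries x n)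
    ((commutator_lowerPSeries_le hn).trans le_sup_right)

theorem lyndonCommutator_pow_mem_lyndonPowerSpan {w : List α} (hw : IsLyndon w) {n : ℕ}
    (hn : w.length ≤ n) : lyndonCommutator x w ^ p ^ (n - w.length) ∈ lyndonPowerSpan x p n :=
  Subgroup.mem_sup_left (Subgroup.subset_closure ⟨w, hw, hn, rfl⟩)

theorem lowerPSeries_le_lyndonPowerSpan_of_lt {m n : ℕ} (h : n < m) :
    lowerPSeries p G m ≤ lyndonPowerSpan x p n :=
  (lowerPSeries_antitone h).trans le_sup_right

theorem gammaSeries_le_lyndonPowerSpan [Finite α] (hx : Subgroup.closure (Set.range x) = ⊤)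
    {n : ℕ} (hn : 1 ≤ n) : gammaSeries G n ≤ lyndonPowerSpan x p n := by
  refine (gammaSeries_le_lyndonSpan x hx hn).trans
    (sup_le_sup (Subgroup.closure_mono ?_) (gammaSeries_le_lowerPSeries (by omega)))
  rintro _ ⟨w, hw, rfl, rfl⟩
  exact ⟨w, hw, le_rfl, by simp⟩

/-- `[P_n, P_n] ≤ P_{n+2}` if `n ≥ 2`; for `n = 1` the left side is `γ_2`, which is spanned by
commutators of Lyndon words. -/
theorem commutator_lowerPSeries_self_le [Finite α] (hx : Subgroup.closure (Set.range x) = ⊤)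
    {n : ℕ} (hn : 1 ≤ n) :
    ⁅lowerPSeries p G n, lowerPSeries p G n⁆ ≤ lyndonPowerSpan x p (n + 1) := by
  rcases hn.eq_or_lt with rfl | hn
  · refine le_trans ?_ (gammaSeries_le_lyndonPowerSpan x hx (by omega))
    rw [gammaSeries_succ G le_rfl]
    exact Subgroup.commutator_mono le_top le_top
  · exact ((Subgroup.commutator_mono le_rfl (lowerPSeries_antitone hn)).trans
      (commutator_lowerPSeries_two_le (by omega))).trans le_sup_right

theorem pow_mem_lyndonPowerSpan [Finite α] (hx : Subgroup.closure (Set.range x) = ⊤) {n : ℕ}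
    (hn : 1 ≤ n) {a : G} (ha : a ∈ lyndonPowerSpan x p n) :
    a ^ p ∈ lyndonPowerSpan x p (n + 1) := by
  have := lyndonPowerSpan_normal x (p := p) (n := n + 1) (by omega)
  suffices lyndonPowerSpan x p n ≤ powPreimage (lowerPSeries p G n) (lyndonPowerSpan x p (n + 1)) p
      (commutator_lowerPSeries_self_le x hx hn) from (this ha).2
  refine sup_le ((Subgroup.closure_le _).2 ?_) fun b hb =>
    ⟨lowerPSeries_antitone n.le_succ hb, Subgroup.mem_sup_right
      (pow_mem_lowerPSeries (by omega) hb)⟩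
  rintro _ ⟨w, hw, hwn, rfl⟩
  refine ⟨lyndonCommutator_pow_mem_lowerPSeries x hw hwn, ?_⟩
  rw [← pow_mul, ← pow_succ, ← Nat.sub_add_comm hwn]
  exact lyndonCommutator_pow_mem_lyndonPowerSpan x hw (by omega)

theorem commutator_pow_mem_lyndonPowerSpan [Finite α]
    (hx : Subgroup.closure (Set.range x) = ⊤) {i : ℕ} (hi : 1 ≤ i) {c : G}
    (hc : c ∈ gammaSeries G i) (g : G) (k : ℕ) :
    ⁅c ^ p ^ k, g⁆ ∈ lyndonPowerSpan x p (i + k + 1) := by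
  have hg : g ∈ gammaSeries G 1 := Subgroup.mem_top g
  induction k with
  | zero =>
    rw [pow_zero, pow_one]
    exact gammaSeries_le_lyndonPowerSpan x hx (by omega)
      (commutator_mem_gammaSeries hc hg hi le_rfl (by omega))
  | succ k ih =>
    have hK := lyndonPowerSpan_normal x (p := p) (n := i + (k + 1) + 1) (by omega)
    have hpow := pow_mem_lyndonPowerSpan x hx (by omega) ih
    have hy : c ^ p ^ k ∈ lowerPSeries p G (i + k) :=
      pow_pow_mem_lowerPSeries hi (gammaSeries_le_lowerPSeries hi hc) k
    have hz : ⁅c ^ p ^ k, g⁆ ∈ lowerPSeries p G (i + k + 1) :=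
      commutator_mem_lowerPSeries (by omega) hy g
    -- `c ^ p ^ k` commutes with `[c ^ p ^ k, g]` modulo the span, so taking `p`-th powers of the
    -- first entry of the commutator amounts to taking the `p`-th power of the commutator.
    have hcomm : ⁅⁅c ^ p ^ k, g⁆, c ^ p ^ k⁆ ∈ lyndonPowerSpan x p (i + (k + 1) + 1) := by
      rcases Nat.lt_or_ge (i + k) 2 with h | h
      · obtain ⟨rfl, rfl⟩ : i = 1 ∧ k = 0 := by omega
        rw [pow_zero, pow_one]
        exact gammaSeries_le_lyndonPowerSpan x hx (by omega) (commutator_mem_gammaSeries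
          (commutator_mem_gammaSeries hc hg hi le_rfl le_rfl) hc (by omega) hi (by omega))
      · exact lowerPSeries_le_lyndonPowerSpan_of_lt x (by omega)
          (commutator_lowerPSeries_two_le (by omega) (Subgroup.commutator_mem_commutator hz
            (lowerPSeries_antitone h hy)))
    rw [pow_succ, pow_mul]
    rw [commutator_mem_iff_commute] at hcomm
    rw [← QuotientGroup.eq_one_iff, QuotientGroup.mk_pow] at hpow
    rw [← QuotientGroup.eq_one_iff]
    generalize c ^ p ^ k = y at *
    have e : ((⁅y ^ p, g⁆ : G) : G ⧸ lyndonPowerSpan x p (i + (k + 1) + 1)) =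
        (y : G ⧸ _) ^ p * ((y : G ⧸ _)⁻¹ * ((⁅y, g⁆ : G) : G ⧸ _)) ^ p := by
      have : ⁅y ^ p, g⁆ = y ^ p * (y⁻¹ * ⁅y, g⁆) ^ p := by
        rw [show y⁻¹ * ⁅y, g⁆ = g * y⁻¹ * g⁻¹ by simp [commutatorElement_def, mul_assoc], conj_pow,
          commutatorElement_def]
        simp [mul_assoc]
      rw [this]
      rfl
    rw [e, hcomm.symm.inv_left.mul_pow, inv_pow, mul_inv_cancel_left]
    exact hpow

/-- In a group generated by the `x a`, the powers `c_w ^ p ^ (n - |w|)` of the commutators of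
Lyndon words `w` of length at most `n` generate `P_n` modulo `P_{n+1}`. -/
theorem lowerPSeries_le_lyndonPowerSpan [Finite α] (hx : Subgroup.closure (Set.range x) = ⊤)
    {n : ℕ} (hn : 1 ≤ n) : lowerPSeries p G n ≤ lyndonPowerSpan x p n := by
  induction n, hn using Nat.le_induction with
  | base =>
    rw [lowerPSeries_one, ← gammaSeries_one]
    exact gammaSeries_le_lyndonPowerSpan x hx le_rfl
  | succ n hn ih =>
    have := lyndonPowerSpan_normal x (p := p) (n := n + 1) (by omega)
    rw [lowerPSeries_succ hn]
    refine sup_le (Subgroup.commutator_le.2 fun a ha g _ => ?_)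
      (powSubgroup_le fun a ha => pow_mem_lyndonPowerSpan x hx hn (ih ha))
    suffices lyndonPowerSpan x p n ≤ centralizerMod (lyndonPowerSpan x p (n + 1)) g from
      mem_centralizerMod.1 (this (ih ha))
    refine sup_le ((Subgroup.closure_le _).2 ?_) fun b hb => mem_centralizerMod.2
      (Subgroup.mem_sup_right (commutator_mem_lowerPSeries (by omega) hb g))
    rintro _ ⟨w, hw, hwn, rfl⟩
    have := commutator_pow_mem_lyndonPowerSpan x (p := p) hx hw.one_le_length
      (lyndonCommutator_mem_gammaSeries x hw) g (n - w.length)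
    rw [Nat.add_sub_cancel' hwn] at this
    exact mem_centralizerMod.2 this

/-! ### Comparison of the two descriptions of the series -/

theorem powSubgroup_le_lambdaSeries {i n : ℕ} (hi : 1 ≤ i) (hn : i ≤ n) :
    powSubgroup (gammaSeries G i) (p ^ (n - i)) ≤ lambdaSeries p G n :=
  le_iSup₂_of_le i (Finset.mem_Icc.2 ⟨hi, hn⟩) le_rfl

theorem lambdaSeries_le_lowerPSeries (n : ℕ) : lambdaSeries p G n ≤ lowerPSeries p G n := by
  refine iSup₂_le fun i hi => powSubgroup_le fun a ha => ?_
  rw [Finset.mem_Icc] at hi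
  have := pow_pow_mem_lowerPSeries (p := p) hi.1 (gammaSeries_le_lowerPSeries hi.1 ha) (n - i)
  rwa [Nat.add_sub_cancel' hi.2] at this

theorem gammaSeries_le_lambdaSeries {n : ℕ} (hn : 1 ≤ n) :
    gammaSeries G n ≤ lambdaSeries p G n := fun a ha =>
  powSubgroup_le_lambdaSeries hn le_rfl (by simpa using pow_mem_powSubgroup ha (p ^ (n - n)))

theorem lambdaSeries_succ_le {n : ℕ} (hn : 1 ≤ n) :
    lambdaSeries p G (n + 1) ≤ lambdaSeries p G n := by
  refine iSup₂_le fun i hi => ?_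
  rw [Finset.mem_Icc] at hi
  rcases hi.2.eq_or_lt with rfl | h
  · refine powSubgroup_le fun a ha => pow_mem ?_ _
    exact gammaSeries_le_lambdaSeries hn (gammaSeries_antitone n.le_succ ha)
  · refine le_trans (powSubgroup_le fun a ha => ?_)
      (powSubgroup_le_lambdaSeries hi.1 (Nat.lt_succ_iff.1 h))
    rw [Nat.sub_add_comm (Nat.lt_succ_iff.1 h), pow_succ', pow_mul]
    exact pow_mem_powSubgroup (pow_mem ha p) _

theorem lyndonPowerSpan_le_lambdaSeries_sup {n : ℕ} :
    lyndonPowerSpan x p n ≤ lambdaSeries p G n ⊔ lowerPSeries p G (n + 1) := by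
  refine sup_le_sup_right ((Subgroup.closure_le _).2 ?_) _
  rintro _ ⟨w, hw, hwn, rfl⟩
  exact powSubgroup_le_lambdaSeries hw.one_le_length hwn
    (pow_mem_powSubgroup (lyndonCommutator_mem_gammaSeries x hw) _)

theorem lowerPSeries_le_lambdaSeries_sup [Finite α] (hx : Subgroup.closure (Set.range x) = ⊤)
    {n : ℕ} (hn : 1 ≤ n) {m : ℕ} (hm : n ≤ m) :
    lowerPSeries p G n ≤ lambdaSeries p G n ⊔ lowerPSeries p G m := by
  have anti : ∀ m, n ≤ m → lambdaSeries p G m ≤ lambdaSeries p G n := by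
    intro m hm
    induction m, hm using Nat.le_induction with
    | base => exact le_rfl
    | succ m hm ih => exact (lambdaSeries_succ_le (by omega)).trans ih
  induction m, hm using Nat.le_induction with
  | base => exact le_sup_right
  | succ m hm ih =>
    refine ih.trans (sup_le le_sup_left ?_)
    exact ((lowerPSeries_le_lyndonPowerSpan x hx (by omega)).trans
      (lyndonPowerSpan_le_lambdaSeries_sup x)).trans (sup_le_sup_right (anti m hm) _)

/-- If `P_m` is contained, modulo `M`, in a subgroup `A` that is central modulo `M`, then the
further terms of the series are contained in the subgroups `A ^ p ^ k`, modulo `M`. -/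
theorem lowerPSeries_add_le_powSubgroup_sup {A M : Subgroup G} [A.Normal] [M.Normal] {m : ℕ}
    (hm : 1 ≤ m) (hA : ⁅A, (⊤ : Subgroup G)⁆ ≤ M) (h : lowerPSeries p G m ≤ A ⊔ M) (k : ℕ) :
    lowerPSeries p G (m + k) ≤ powSubgroup A (p ^ k) ⊔ M := by
  have central : ∀ a ∈ A ⊔ M, ∀ g, ⁅a, g⁆ ∈ M := by
    intro a ha g
    suffices A ⊔ M ≤ centralizerMod M g from mem_centralizerMod.1 (this ha)
    refine sup_le (fun b hb => mem_centralizerMod.2 ?_) fun b hb => mem_centralizerMod.2 ?_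
    · exact hA (Subgroup.commutator_mem_commutator hb (Subgroup.mem_top g))
    · exact Subgroup.commutator_le_left M ⊤
        (Subgroup.commutator_mem_commutator hb (Subgroup.mem_top g))
  induction k with
  | zero =>
    have h1 : A ≤ powSubgroup A 1 := fun a ha => by
      have := pow_mem_powSubgroup ha 1
      rwa [pow_one] at this
    rw [pow_zero, add_zero]
    exact h.trans (sup_le_sup_right h1 M)
  | succ k ih =>
    have hle : powSubgroup A (p ^ k) ⊔ M ≤ A ⊔ M :=
      sup_le_sup_right (powSubgroup_le fun a ha => pow_mem ha _) M
    have habel : ⁅A ⊔ M, A ⊔ M⁆ ≤ powSubgroup A (p ^ (k + 1)) ⊔ M :=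
      Subgroup.commutator_le.2 fun a ha g _ => Subgroup.mem_sup_right (central a ha g)
    rw [← add_assoc, lowerPSeries_succ (by omega)]
    refine sup_le (Subgroup.commutator_le.2 fun a ha g _ =>
      Subgroup.mem_sup_right (central a (hle (ih ha)) g)) (powSubgroup_le fun a ha => ?_)
    suffices powSubgroup A (p ^ k) ⊔ M ≤
        powPreimage (A ⊔ M) (powSubgroup A (p ^ (k + 1)) ⊔ M) p habel from (this (ih ha)).2
    refine sup_le (powSubgroup_le fun b hb => ?_) fun b hb =>
      mem_powPreimage.2 ⟨Subgroup.mem_sup_right hb, Subgroup.mem_sup_right (pow_mem hb p)⟩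
    refine mem_powPreimage.2 ⟨Subgroup.mem_sup_left (pow_mem hb _), Subgroup.mem_sup_left ?_⟩
    rw [← pow_mul, ← pow_succ]
    exact pow_mem_powSubgroup hb _

/-- `G ⧸ λ_n` is nilpotent of exponent dividing `p ^ (n - 1)`, so its lower exponent-`p` central
series reaches the trivial group: it descends through each (central) lower central factor in
finitely many steps. -/
theorem exists_lowerPSeries_le_lambdaSeries (p : ℕ) (G : Type*) [Group G] {n : ℕ} (hn : 1 ≤ n) :
    ∃ m, lowerPSeries p G m ≤ lambdaSeries p G n := by
  suffices h : ∀ i, 1 ≤ i →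
      ∃ m, 1 ≤ m ∧ lowerPSeries p G m ≤ gammaSeries G i ⊔ lambdaSeries p G n by
    obtain ⟨m, -, hm⟩ := h n hn
    exact ⟨m, hm.trans (sup_le (gammaSeries_le_lambdaSeries hn) le_rfl)⟩
  intro i hi
  induction i, hi using Nat.le_induction with
  | base => exact ⟨1, le_rfl, le_top.trans le_sup_left⟩
  | succ i hi ih =>
    obtain ⟨m, hm1, hm⟩ := ih
    have step := lowerPSeries_add_le_powSubgroup_sup
      (M := gammaSeries G (i + 1) ⊔ lambdaSeries p G n) hm1
      ((gammaSeries_succ G hi).ge.trans le_sup_left)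
      (hm.trans (sup_le_sup_left le_sup_right _)) (n - 1)
    refine ⟨m + (n - 1), by omega, step.trans (sup_le (powSubgroup_le fun a _ => ?_) le_rfl)⟩
    exact Subgroup.mem_sup_right (powSubgroup_le_lambdaSeries le_rfl hn
      (pow_mem_powSubgroup (Subgroup.mem_top a) _))

theorem lowerPSeries_eq_lambdaSeries [Finite α] (hx : Subgroup.closure (Set.range x) = ⊤)
    {n : ℕ} (hn : 1 ≤ n) : lowerPSeries p G n = lambdaSeries p G n := by
  refine le_antisymm ?_ (lambdaSeries_le_lowerPSeries n)
  obtain ⟨m, hm⟩ := exists_lowerPSeries_le_lambdaSeries p G hn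
  exact (lowerPSeries_le_lambdaSeries_sup x hx hn (le_max_left n m)).trans
    (sup_le le_rfl ((lowerPSeries_antitone (le_max_right n m)).trans hm))

end LowerPSeries

/-! ### The filtration by powers of the ideal generated by `p` and the letters -/

section Filtration

/-- The `m`-th power of the ideal generated by `p` and the letters: the series in which the
coefficient of `w` is divisible by `p ^ (m - |w|)`. -/
def seriesFiltration (α : Type*) (p m : ℕ) : AddSubgroup (List α → ℤ) where
  carrier := {f | ∀ w, (p : ℤ) ^ (m - w.length) ∣ f w}
  zero_mem' := fun _ => dvd_zero _
  add_mem' := fun hf hg w => dvd_add (hf w) (hg w)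
  neg_mem' := fun hf w => (hf w).neg_right

/-- The operators that raise the filtration degree by at least `n`. -/
def opFiltration (α : Type*) (p n : ℕ) : AddSubgroup (Module.End ℤ (List α → ℤ)) where
  carrier := {T | ∀ m, ∀ f ∈ seriesFiltration α p m, T f ∈ seriesFiltration α p (m + n)}
  zero_mem' := fun _ _ _ => zero_mem _
  add_mem' := fun hS hT m f hf => add_mem (hS m f hf) (hT m f hf)
  neg_mem' := fun hT m f hf => neg_mem (hT m f hf)

variable {α : Type*} {p : ℕ}

theorem seriesFiltration_antitone : Antitone (seriesFiltration α p) := fun _ _ h _ hf w =>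
  (pow_dvd_pow _ (by omega)).trans (hf w)

theorem opFiltration_antitone : Antitone (opFiltration α p) := fun _ _ h _ hT m f hf =>
  seriesFiltration_antitone (by omega) (hT m f hf)

theorem mul_mem_opFiltration {m n : ℕ} {S T : Module.End ℤ (List α → ℤ)}
    (hS : S ∈ opFiltration α p m) (hT : T ∈ opFiltration α p n) :
    S * T ∈ opFiltration α p (m + n) := by
  intro k f hf
  have := hS _ _ (hT k f hf)
  rwa [add_assoc, add_comm n m] at this

theorem one_mem_opFiltration : 1 ∈ opFiltration α p 0 := fun _ _ hf => hf

theorem natCast_mem_opFiltration :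
    (p : Module.End ℤ (List α → ℤ)) ∈ opFiltration α p 1 := by
  intro m f hf w
  rw [Module.End.natCast_apply, Pi.smul_apply, nsmul_eq_mul]
  refine (pow_dvd_pow _ (by omega : m + 1 - w.length ≤ (m - w.length) + 1)).trans ?_
  rw [pow_succ']
  exact mul_dvd_mul_left _ (hf w)

end Filtration

/-! ### The Magnus representation -/

section Magnus

variable {α : Type*} [LinearOrder α] {p : ℕ}

/-- Left multiplication by the letter `a` on the noncommutative formal power series
`∑ w, f w • w` with integer coefficients, which are encoded as functions on words. -/
def letterMul (a : α) : Module.End ℤ (List α → ℤ) where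
  toFun f
    | [] => 0
    | b :: w => if b = a then f w else 0
  map_add' f g := by
    funext w
    rcases w with _ | ⟨b, w⟩
    · rfl
    · by_cases h : b = a <;> simp [h]
  map_smul' c f := by
    funext w
    rcases w with _ | ⟨b, w⟩
    · simp
    · by_cases h : b = a <;> simp [h]

theorem letterMul_nil (a : α) (f : List α → ℤ) : letterMul a f [] = 0 := rfl

theorem letterMul_cons (a b : α) (f : List α → ℤ) (w : List α) :
    letterMul a f (b :: w) = if b = a then f w else 0 := rfl

/-- The series `(1 + a)⁻¹ f`, whose coefficients are determined by recursion on the length. -/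
def oneAddLetterInvFun (a : α) (f : List α → ℤ) : List α → ℤ
  | [] => f []
  | b :: w => f (b :: w) - if b = a then oneAddLetterInvFun a f w else 0

/-- Multiplication by `(1 + a)⁻¹` on formal power series. -/
def oneAddLetterInv (a : α) : Module.End ℤ (List α → ℤ) where
  toFun := oneAddLetterInvFun a
  map_add' f g := by
    funext w
    induction w with
    | nil => rfl
    | cons b w ih =>
      rw [Pi.add_apply] at ih
      by_cases h : b = a
      · simp only [oneAddLetterInvFun, h, if_true, ih, Pi.add_apply]
        ring
      · simp [oneAddLetterInvFun, h]
  map_smul' c f := by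
    funext w
    induction w with
    | nil => rfl
    | cons b w ih =>
      rw [Pi.smul_apply] at ih
      by_cases h : b = a
      · simp only [oneAddLetterInvFun, h, if_true, ih, Pi.smul_apply, smul_eq_mul,
          RingHom.id_apply]
        ring
      · simp [oneAddLetterInvFun, h]

theorem oneAddLetterInv_nil (a : α) (f : List α → ℤ) : oneAddLetterInv a f [] = f [] := rfl

theorem oneAddLetterInv_cons (a b : α) (f : List α → ℤ) (w : List α) :
    oneAddLetterInv a f (b :: w) =
      f (b :: w) - if b = a then oneAddLetterInv a f w else 0 := rfl

/-- The operator of multiplication by `1 + a`, as a unit. -/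
def oneAddLetter (a : α) : (Module.End ℤ (List α → ℤ))ˣ where
  val := 1 + letterMul a
  inv := oneAddLetterInv a
  val_inv := by
    refine LinearMap.ext fun f => funext fun w => ?_
    rcases w with _ | ⟨b, w⟩
    · simp [oneAddLetterInv_nil, letterMul_nil]
    · simp [oneAddLetterInv_cons, letterMul_cons]
  inv_val := by
    refine LinearMap.ext fun f => funext fun w => ?_
    change oneAddLetterInv a (f + letterMul a f) w = f w
    induction w with
    | nil => simp [oneAddLetterInv_nil, letterMul_nil]
    | cons b w ih =>
      rw [oneAddLetterInv_cons, ih, Pi.add_apply, letterMul_cons]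
      ring

/-- The Magnus representation of the free group: a free generator `a` acts on formal power series
as multiplication by `1 + a`. -/
def magnus : FreeGroup α →* (Module.End ℤ (List α → ℤ))ˣ :=
  FreeGroup.lift oneAddLetter

/-- The operator by which an element of the free group acts on formal power series. -/
def magnusOp (g : FreeGroup α) : Module.End ℤ (List α → ℤ) := magnus g

theorem magnusOp_one : magnusOp (1 : FreeGroup α) = 1 := by simp [magnusOp]

theorem magnusOp_mul (g h : FreeGroup α) : magnusOp (g * h) = magnusOp g * magnusOp h := by
  simp [magnusOp]

theorem magnusOp_pow (g : FreeGroup α) (n : ℕ) : magnusOp (g ^ n) = magnusOp g ^ n := by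
  simp [magnusOp]

theorem magnusOp_of (a : α) : magnusOp (FreeGroup.of a) = 1 + letterMul a := by
  simp [magnusOp, magnus, oneAddLetter]

theorem magnusOp_of_inv (a : α) : magnusOp (FreeGroup.of a)⁻¹ = oneAddLetterInv a := by
  simp [magnusOp, magnus, oneAddLetter]

theorem magnusOp_inv_mul (g : FreeGroup α) : magnusOp g⁻¹ * magnusOp g = 1 := by
  rw [← magnusOp_mul, inv_mul_cancel, magnusOp_one]

theorem magnusOp_commutator_sub_one (g h : FreeGroup α) : magnusOp ⁅g, h⁆ - 1 =
    ((magnusOp g - 1) * (magnusOp h - 1) - (magnusOp h - 1) * (magnusOp g - 1)) *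
      magnusOp (g⁻¹ * h⁻¹) := by
  have e : (magnusOp g - 1) * (magnusOp h - 1) - (magnusOp h - 1) * (magnusOp g - 1) =
      magnusOp (g * h) - magnusOp (h * g) := by
    rw [magnusOp_mul, magnusOp_mul]
    noncomm_ring
  rw [e, sub_mul, ← magnusOp_mul, ← magnusOp_mul, commutatorElement_def]
  simp [mul_assoc, magnusOp_one]

theorem magnusOp_pow_sub_one (g : FreeGroup α) (n : ℕ) : magnusOp (g ^ n) - 1 =
    (magnusOp g - 1) * ∑ j ∈ Finset.range n, magnusOp (g ^ j) := by
  simp only [magnusOp_pow]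
  rw [mul_geom_sum]

/-- To prove a multiplicative property of the operators `magnusOp g` it suffices to check it on
the generators and their inverses. -/
theorem magnusOp_induction {motive : Module.End ℤ (List α → ℤ) → Prop} (one : motive 1)
    (letter : ∀ a, motive (1 + letterMul a)) (inv : ∀ a, motive (oneAddLetterInv a))
    (mul : ∀ S T, motive S → motive T → motive (S * T)) (g : FreeGroup α) :
    motive (magnusOp g) := by
  induction g using FreeGroup.induction_on with
  | C1 => rw [magnusOp_one]; exact one
  | of a => exact magnusOp_of a ▸ letter a
  | inv_of a _ => exact magnusOp_of_inv a ▸ inv a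
  | mul g h hg hh => rw [magnusOp_mul]; exact mul _ _ hg hh

theorem letterMul_mem_opFiltration (a : α) : letterMul a ∈ opFiltration α p 1 := by
  intro m f hf w
  rcases w with _ | ⟨b, w⟩
  · exact dvd_zero _
  · rw [letterMul_cons, List.length_cons, Nat.add_sub_add_right]
    split_ifs
    · exact hf w
    · exact dvd_zero _

theorem oneAddLetterInv_mem_opFiltration (a : α) : oneAddLetterInv a ∈ opFiltration α p 0 := by
  intro m f hf w
  rw [add_zero]
  induction w with
  | nil => exact hf []
  | cons b w ih =>
    rw [oneAddLetterInv_cons]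
    refine dvd_sub (hf _) ?_
    split_ifs
    · exact (pow_dvd_pow _ (by simp; omega)).trans ih
    · exact dvd_zero _

theorem magnusOp_mem_opFiltration (g : FreeGroup α) : magnusOp g ∈ opFiltration α p 0 :=
  magnusOp_induction one_mem_opFiltration
    (fun a => add_mem one_mem_opFiltration
      (opFiltration_antitone zero_le_one (letterMul_mem_opFiltration a)))
    oneAddLetterInv_mem_opFiltration (fun _ _ => mul_mem_opFiltration) g

/-- The subgroup of the free group that acts as the identity modulo degree `n`. -/
def congruenceSubgroup (α : Type*) [LinearOrder α] (p n : ℕ) : Subgroup (FreeGroup α) where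
  carrier := {g | magnusOp g - 1 ∈ opFiltration α p n}
  one_mem' := by
    change magnusOp 1 - 1 ∈ opFiltration α p n
    rw [magnusOp_one, sub_self]
    exact zero_mem _
  mul_mem' := by
    intro g h hg hh
    have e : magnusOp (g * h) - 1 = magnusOp g * (magnusOp h - 1) + (magnusOp g - 1) := by
      rw [magnusOp_mul]
      noncomm_ring
    change magnusOp (g * h) - 1 ∈ opFiltration α p n
    rw [e]
    refine add_mem ?_ hg
    have := mul_mem_opFiltration (magnusOp_mem_opFiltration (p := p) g) hh
    rwa [zero_add] at this
  inv_mem' := by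
    intro g hg
    have e : magnusOp g⁻¹ - 1 = -(magnusOp g⁻¹ * (magnusOp g - 1)) := by
      rw [mul_sub, magnusOp_inv_mul, mul_one, neg_sub]
    change magnusOp g⁻¹ - 1 ∈ opFiltration α p n
    rw [e]
    refine neg_mem ?_
    have := mul_mem_opFiltration (magnusOp_mem_opFiltration (p := p) g⁻¹) hg
    rwa [zero_add] at this

theorem mem_congruenceSubgroup {n : ℕ} {g : FreeGroup α} :
    g ∈ congruenceSubgroup α p n ↔ magnusOp g - 1 ∈ opFiltration α p n :=
  Iff.rfl

theorem congruenceSubgroup_one : congruenceSubgroup α p 1 = ⊤ := by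
  rw [eq_top_iff, ← FreeGroup.closure_range_of, Subgroup.closure_le]
  rintro _ ⟨a, rfl⟩
  rw [SetLike.mem_coe, mem_congruenceSubgroup, magnusOp_of, add_sub_cancel_left]
  exact letterMul_mem_opFiltration a

theorem lowerPSeries_le_congruenceSubgroup {n : ℕ} (hn : 1 ≤ n) :
    lowerPSeries p (FreeGroup α) n ≤ congruenceSubgroup α p n := by
  have one : ∀ g : FreeGroup α, magnusOp g - 1 ∈ opFiltration α p 1 := fun g => by
    rw [← mem_congruenceSubgroup, congruenceSubgroup_one]
    exact Subgroup.mem_top g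
  induction n, hn using Nat.le_induction with
  | base => rw [congruenceSubgroup_one]; exact le_top
  | succ n hn ih =>
    rw [lowerPSeries_succ hn]
    refine sup_le (Subgroup.commutator_le.2 fun g hg h _ => ?_) (powSubgroup_le fun g hg => ?_)
    · have hg := mem_congruenceSubgroup.1 (ih hg)
      rw [mem_congruenceSubgroup, magnusOp_commutator_sub_one]
      refine mul_mem_opFiltration (n := 0) (sub_mem ?_ ?_) (magnusOp_mem_opFiltration _)
      · exact mul_mem_opFiltration hg (one h)
      · rw [add_comm]
        exact mul_mem_opFiltration (one h) hg
    · have hg := mem_congruenceSubgroup.1 (ih hg)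
      rw [mem_congruenceSubgroup, magnusOp_pow_sub_one]
      refine mul_mem_opFiltration hg ?_
      have e : ∑ j ∈ Finset.range p, magnusOp (g ^ j) =
          ∑ j ∈ Finset.range p, (magnusOp (g ^ j) - 1) + (p : Module.End ℤ (List α → ℤ)) := by
        simp
      rw [e]
      exact add_mem (sum_mem fun j _ => one _) natCast_mem_opFiltration

/-! ### Leading words -/

/-- The sort key for the order of words by length, and then lexicographically. -/
def shortlexKey (w : List α) : ℕ ×ₗ List α := toLex (w.length, w)

theorem shortlexKey_lt_iff {v w : List α} : shortlexKey v < shortlexKey w ↔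
    v.length < w.length ∨ v.length = w.length ∧ v < w :=
  Prod.Lex.lt_iff

/-- The series `f` has coefficient `c` at the word `s`, and no terms before `s` in the order by
length and then lexicographically. -/
def HasLeadingTerm (f : List α → ℤ) (s : List α) (c : ℤ) : Prop :=
  f s = c ∧ ∀ v, shortlexKey v < shortlexKey s → f v = 0

/-- The operator `T` acts on leading words by prepending the word `u`. -/
def PrependsLeading (T : Module.End ℤ (List α → ℤ)) (u : List α) : Prop :=
  ∀ f s c, HasLeadingTerm f s c → HasLeadingTerm (T f) (u ++ s) c

theorem HasLeadingTerm.add_of_lt {f g : List α → ℤ} {s t : List α} {a b : ℤ}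
    (hf : HasLeadingTerm f s a) (hg : HasLeadingTerm g t b)
    (h : shortlexKey s < shortlexKey t) : HasLeadingTerm (f + g) s a :=
  ⟨by rw [Pi.add_apply, hf.1, hg.2 s h, add_zero],
    fun v hv => by rw [Pi.add_apply, hf.2 v hv, hg.2 v (hv.trans h), add_zero]⟩

theorem HasLeadingTerm.neg {f : List α → ℤ} {s : List α} {a : ℤ} (hf : HasLeadingTerm f s a) :
    HasLeadingTerm (-f) s (-a) :=
  ⟨by rw [Pi.neg_apply, hf.1], fun v hv => by rw [Pi.neg_apply, hf.2 v hv, neg_zero]⟩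

theorem PrependsLeading.mul {S T : Module.End ℤ (List α → ℤ)} {u v : List α}
    (hS : PrependsLeading S u) (hT : PrependsLeading T v) : PrependsLeading (S * T) (u ++ v) :=
  fun f s c hf => by
    rw [List.append_assoc]
    exact hS _ _ _ (hT f s c hf)

theorem prependsLeading_one : PrependsLeading (1 : Module.End ℤ (List α → ℤ)) [] :=
  fun _ _ _ hf => hf

theorem prependsLeading_letterMul (a : α) : PrependsLeading (letterMul a) [a] := by
  intro f s c hf
  refine ⟨by rw [List.singleton_append, letterMul_cons, if_pos rfl, hf.1], fun v hv => ?_⟩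
  rcases v with _ | ⟨b, w⟩
  · rfl
  · rw [letterMul_cons]
    split_ifs with h
    · subst h
      refine hf.2 w ?_
      rw [shortlexKey_lt_iff] at hv ⊢
      simpa using hv
    · rfl

theorem prependsLeading_magnusOp (g : FreeGroup α) : PrependsLeading (magnusOp g) [] := by
  refine magnusOp_induction (motive := fun T => PrependsLeading T []) prependsLeading_one
    (fun a f s c hf => ?_) (fun a f s c hf => ?_) (fun S T => PrependsLeading.mul) g
  · exact hf.add_of_lt (prependsLeading_letterMul a f s c hf)
      (shortlexKey_lt_iff.2 (Or.inl (by simp)))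
  · -- The inverse of `1 + a` does not change coefficients up to the leading word.
    have key : ∀ v, shortlexKey v ≤ shortlexKey s → oneAddLetterInv a f v = f v := by
      intro v
      induction v with
      | nil => intro _; rfl
      | cons b w ih =>
        intro h
        have hlt : shortlexKey w < shortlexKey s :=
          lt_of_lt_of_le (shortlexKey_lt_iff.2 (Or.inl (by simp))) h
        rw [oneAddLetterInv_cons, ih hlt.le, hf.2 w hlt, ite_self, sub_zero]
    exact ⟨(key s le_rfl).trans hf.1, fun v hv => (key v hv.le).trans (hf.2 v hv)⟩

/-- If `u ++ v` precedes `v ++ u`, then the leading words of the two products `S * T` and `T * S`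
do not interfere in the commutator. -/
theorem PrependsLeading.mul_sub_mul {S T : Module.End ℤ (List α → ℤ)} {u v : List α}
    (hS : PrependsLeading S u) (hT : PrependsLeading T v) (h : u ++ v < v ++ u) :
    PrependsLeading (S * T - T * S) (u ++ v) := by
  intro f s c hf
  rw [LinearMap.sub_apply, sub_eq_add_neg]
  refine ((hS.mul hT) f s c hf).add_of_lt (((hT.mul hS) f s c hf).neg)
    (shortlexKey_lt_iff.2 (Or.inr ⟨by simp [add_left_comm], ?_⟩))
  exact List.append_lt_append_of_lt_of_length_le h (by simp [add_comm]) s s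

/-- The Lyndon commutator of `w` acts as `1 + w + ⋯`, where the omitted terms come after `w`. -/
theorem prependsLeading_lyndonCommutator {w : List α} (hw : IsLyndon w) :
    PrependsLeading (magnusOp (lyndonCommutator FreeGroup.of w) - 1) w := by
  refine hw.induction (motive := fun w =>
    PrependsLeading (magnusOp (lyndonCommutator FreeGroup.of w) - 1) w) (fun a => ?_)
    fun u v hs _ _ hw ihu ihv => ?_
  · rw [lyndonCommutator_singleton, magnusOp_of, add_sub_cancel_left]
    exact prependsLeading_letterMul a
  · rw [lyndonCommutator_append _ hs, magnusOp_commutator_sub_one]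
    have := (ihu.mul_sub_mul ihv (hw.append_lt_append_swap hs.1 hs.2.1)).mul
      (prependsLeading_magnusOp
        ((lyndonCommutator FreeGroup.of u)⁻¹ * (lyndonCommutator FreeGroup.of v)⁻¹))
    rwa [List.append_nil] at this

/-- The series `g - 1` attached to an element `g` of the free group by the Magnus embedding. -/
def magnusSeries (g : FreeGroup α) : List α → ℤ := (magnusOp g - 1) (Pi.single [] 1)

theorem hasLeadingTerm_one : HasLeadingTerm (Pi.single [] 1 : List α → ℤ) [] 1 := by
  refine ⟨Pi.single_eq_same _ _, fun v hv => ?_⟩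
  rw [shortlexKey_lt_iff] at hv
  simp at hv

theorem magnusSeries_nil (g : FreeGroup α) : magnusSeries g [] = 0 := by
  have := (prependsLeading_magnusOp g _ _ _ hasLeadingTerm_one).1
  rw [List.append_nil] at this
  rw [magnusSeries, LinearMap.sub_apply, Pi.sub_apply, this]
  simp

theorem hasLeadingTerm_magnusSeries_pow {w : List α} (hw : IsLyndon w) (n : ℕ) :
    HasLeadingTerm (magnusSeries (lyndonCommutator FreeGroup.of w ^ n)) w n := by
  set c := lyndonCommutator FreeGroup.of w
  have hsum : HasLeadingTerm
      ((∑ j ∈ Finset.range n, magnusOp (c ^ j)) (Pi.single [] 1)) [] (n : ℤ) := by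
    refine ⟨?_, fun v hv => ?_⟩
    · have h1 : ∀ j, magnusOp (c ^ j) (Pi.single [] 1) [] = 1 := fun j =>
        (prependsLeading_magnusOp (c ^ j) _ _ _ hasLeadingTerm_one).1
      simp [LinearMap.sum_apply, Finset.sum_apply, h1]
    · rw [shortlexKey_lt_iff] at hv
      simp at hv
  have := prependsLeading_lyndonCommutator hw _ _ _ hsum
  rw [List.append_nil] at this
  rw [magnusSeries, magnusOp_pow_sub_one]
  exact this

end Magnus

/-! ### Membership in the series is detected by the Magnus series -/

section Detection

variable {α : Type*} [LinearOrder α] {p : ℕ}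

theorem single_nil_mem_seriesFiltration :
    (Pi.single [] 1 : List α → ℤ) ∈ seriesFiltration α p 0 := fun w => by simp

theorem magnusSeries_mem_seriesFiltration {n : ℕ} (hn : 1 ≤ n) {g : FreeGroup α}
    (hg : g ∈ lowerPSeries p (FreeGroup α) n) : magnusSeries g ∈ seriesFiltration α p n := by
  have := mem_congruenceSubgroup.1 (lowerPSeries_le_congruenceSubgroup hn hg) _ _
    single_nil_mem_seriesFiltration
  rwa [zero_add] at this

/-- On `P_n` the series `g - 1` is additive in `g`, modulo degree `n + 1`. -/
theorem magnusSeries_mul_sub_mem {n : ℕ} (hn : 1 ≤ n) {g h : FreeGroup α}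
    (hg : g ∈ lowerPSeries p (FreeGroup α) n) (hh : h ∈ lowerPSeries p (FreeGroup α) n) :
    magnusSeries (g * h) - (magnusSeries g + magnusSeries h) ∈ seriesFiltration α p (n + 1) := by
  have e : magnusSeries (g * h) - (magnusSeries g + magnusSeries h) =
      ((magnusOp g - 1) * (magnusOp h - 1)) (Pi.single [] 1) := by
    rw [magnusSeries, magnusSeries, magnusSeries, ← LinearMap.add_apply, ← LinearMap.sub_apply,
      magnusOp_mul]
    congr 1
    noncomm_ring
  have := mul_mem_opFiltration
    (mem_congruenceSubgroup.1 (lowerPSeries_le_congruenceSubgroup hn hg))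
    (mem_congruenceSubgroup.1 (lowerPSeries_le_congruenceSubgroup hn hh)) _ _
    single_nil_mem_seriesFiltration
  rw [e]
  exact seriesFiltration_antitone (by omega) this

/-- The elements of `P_n` whose Magnus coefficient at the word `v` vanishes to the order expected
of elements of `P_{n+1}`. -/
def vanishingSubgroup (p : ℕ) {n : ℕ} (hn : 1 ≤ n) (v : List α) : Subgroup (FreeGroup α) where
  carrier := {g | g ∈ lowerPSeries p (FreeGroup α) n ∧
    (p : ℤ) ^ (n + 1 - v.length) ∣ magnusSeries g v}
  one_mem' := ⟨one_mem _, by simp [magnusSeries, magnusOp_one]⟩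
  mul_mem' := by
    rintro g h ⟨hg, hg'⟩ ⟨hh, hh'⟩
    exact ⟨mul_mem hg hh, (dvd_iff_dvd_of_dvd_sub (magnusSeries_mul_sub_mem hn hg hh v)).2
      (dvd_add hg' hh')⟩
  inv_mem' := by
    rintro g ⟨hg, hg'⟩
    have := magnusSeries_mul_sub_mem hn hg (inv_mem hg) v
    rw [mul_inv_cancel, magnusSeries, magnusOp_one, sub_self, LinearMap.zero_apply, zero_sub,
      Pi.neg_apply, dvd_neg, Pi.add_apply, dvd_add_right hg'] at this
    exact ⟨inv_mem hg, this⟩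

theorem lowerPSeries_succ_le_vanishingSubgroup {n : ℕ} (hn : 1 ≤ n) (v : List α) :
    lowerPSeries p (FreeGroup α) (n + 1) ≤ vanishingSubgroup p hn v := fun _ hg =>
  ⟨lowerPSeries_antitone n.le_succ hg, magnusSeries_mem_seriesFiltration (by omega) hg v⟩

/-- The Magnus series of the generators `c_w ^ p ^ (n - |w|)` of `P_n / P_{n+1}` are linearly
independent over `𝔽_p` modulo degree `n + 1`: the series attached to `w` has leading word `w`, and
the coefficient `p ^ (n - |w|)` there is not divisible by `p ^ (n + 1 - |w|)`. The generators are
eliminated in the order of their leading words. -/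
theorem mem_lowerPSeries_succ_of_mem_closure (hp : p.Prime) {n : ℕ} (hn : 1 ≤ n)
    (S : Finset (List α)) (hS : ∀ w ∈ S, IsLyndon w ∧ w.length ≤ n) {g : FreeGroup α}
    (hg : g ∈ Subgroup.closure ((fun w => lyndonCommutator FreeGroup.of w ^ p ^ (n - w.length)) ''
      (S : Set (List α))) ⊔ lowerPSeries p (FreeGroup α) (n + 1))
    (hg' : magnusSeries g ∈ seriesFiltration α p (n + 1)) :
    g ∈ lowerPSeries p (FreeGroup α) (n + 1) := by
  revert hS hg
  refine Finset.induction_on_min_value shortlexKey S ?_ ?_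
  · intro _ hg
    simpa using hg
  · intro v S hv hmin ih hS hg
    obtain ⟨hvL, hvn⟩ := hS v (Finset.mem_insert_self v S)
    have hS' : ∀ w ∈ S, IsLyndon w ∧ w.length ≤ n := fun w hw =>
      hS w (Finset.mem_insert_of_mem hw)
    set K := Subgroup.closure ((fun w => lyndonCommutator FreeGroup.of w ^ p ^ (n - w.length)) ''
      (S : Set (List α))) ⊔ lowerPSeries p (FreeGroup α) (n + 1) with hK
    have hKP : K ≤ lowerPSeries p (FreeGroup α) n := by
      refine sup_le ((Subgroup.closure_le _).2 ?_) (lowerPSeries_antitone n.le_succ)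
      rintro _ ⟨w, hw, rfl⟩
      exact lyndonCommutator_pow_mem_lowerPSeries _ (hS' w hw).1 (hS' w hw).2
    have hKn : K.Normal := Subgroup.normal_of_commutator_le hKP
      ((commutator_lowerPSeries_le hn).trans le_sup_right)
    have hKD : K ≤ vanishingSubgroup p hn v := by
      refine sup_le ((Subgroup.closure_le _).2 ?_) (lowerPSeries_succ_le_vanishingSubgroup hn v)
      rintro _ ⟨w, hw, rfl⟩
      refine ⟨lyndonCommutator_pow_mem_lowerPSeries _ (hS' w hw).1 (hS' w hw).2, ?_⟩
      have hlt : shortlexKey v < shortlexKey w := by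
        refine lt_of_le_of_ne (hmin w hw) fun h => hv ?_
        have : v = w := congrArg (fun x => (ofLex x).2) h
        exact this ▸ hw
      rw [(hasLeadingTerm_magnusSeries_pow (hS' w hw).1 _).2 v hlt]
      exact dvd_zero _
    set c := lyndonCommutator FreeGroup.of v ^ p ^ (n - v.length) with hc
    have hcP : c ∈ lowerPSeries p (FreeGroup α) n :=
      lyndonCommutator_pow_mem_lowerPSeries _ hvL hvn
    have hcp : c ^ p ∈ lowerPSeries p (FreeGroup α) (n + 1) := pow_mem_lowerPSeries hn hcP
    have hcD : c ∉ vanishingSubgroup p hn v := by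
      rintro ⟨-, h⟩
      rw [hc, (hasLeadingTerm_magnusSeries_pow hvL _).1, Nat.cast_pow] at h
      have hp2 : 2 ≤ p := hp.two_le
      have := (Nat.pow_dvd_pow_iff_le_right hp2).1 (by exact_mod_cast h)
      omega
    rw [Finset.coe_insert, Set.image_insert_eq, Set.insert_eq, Subgroup.closure_union, sup_assoc,
      ← hK, ← Subgroup.zpowers_eq_closure] at hg
    obtain ⟨y, hy, z, hz, rfl⟩ := Subgroup.mem_sup_of_normal_right.1 hg
    obtain ⟨m, rfl⟩ := Subgroup.mem_zpowers_iff.1 hy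
    have hyz : c ^ m * z ∈ vanishingSubgroup p hn v :=
      ⟨mul_mem (zpow_mem hcP m) (hKP hz), hg' v⟩
    have hm : c ^ m ∈ vanishingSubgroup p hn v :=
      (Subgroup.mul_mem_cancel_right _ (hKD hz)).1 hyz
    have hpm : (p : ℤ) ∣ m := by
      by_contra hpm
      obtain ⟨a, b, hab⟩ := (Nat.prime_iff_prime_int.1 hp).coprime_iff_not_dvd.2 hpm
      refine hcD ?_
      have e : c = (c ^ p) ^ a * (c ^ m) ^ b := by
        rw [← zpow_natCast c p, ← zpow_mul, ← zpow_mul, ← zpow_add, mul_comm _ a, mul_comm m b,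
          hab, zpow_one]
      rw [e]
      exact mul_mem (zpow_mem (lowerPSeries_succ_le_vanishingSubgroup hn v hcp) a) (zpow_mem hm b)
    obtain ⟨a, rfl⟩ := hpm
    refine ih hS' (mul_mem ?_ hz)
    rw [zpow_mul, zpow_natCast]
    exact Subgroup.mem_sup_right (zpow_mem hcp a)

/-- The map `P_n / P_{n+1} → J^n / J^{n+1}` induced by the Magnus embedding is injective, where
`J` is the ideal generated by `p` and the letters. -/
theorem mem_lowerPSeries_succ_of_magnusSeries_mem [Finite α] (hp : p.Prime) {n : ℕ} (hn : 1 ≤ n)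
    {g : FreeGroup α} (hg : g ∈ lowerPSeries p (FreeGroup α) n)
    (hg' : magnusSeries g ∈ seriesFiltration α p (n + 1)) :
    g ∈ lowerPSeries p (FreeGroup α) (n + 1) := by
  have hfin : {w : List α | IsLyndon w ∧ w.length ≤ n}.Finite :=
    (List.finite_length_le α n).subset fun w hw => hw.2
  refine mem_lowerPSeries_succ_of_mem_closure hp hn hfin.toFinset
    (fun w hw => hfin.mem_toFinset.1 hw) ?_ hg'
  refine sup_le_sup_right (Subgroup.closure_mono ?_) _
    (lowerPSeries_le_lyndonPowerSpan FreeGroup.of (FreeGroup.closure_range_of _) hn hg)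
  rintro _ ⟨w, hw, hwn, rfl⟩
  exact ⟨w, by simpa using ⟨hw, hwn⟩, rfl⟩

end Detection

/-! ### Centralizers modulo the series -/

section Center

variable {α : Type*} [LinearOrder α] {p : ℕ}

/-- Right multiplication of a formal power series by the letter `a`. -/
def letterMulRight (a : α) (f : List α → ℤ) (w : List α) : ℤ :=
  if w.getLast? = some a then f w.dropLast else 0

theorem letterMul_letterMulRight (a b : α) (f : List α → ℤ) :
    letterMul b (letterMulRight a f) = letterMulRight a (letterMul b f) := by
  funext w
  rcases w with _ | ⟨c, _ | ⟨c', w⟩⟩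
  · simp [letterMulRight, letterMul_nil]
  · simp [letterMulRight, letterMul_cons, letterMul_nil]
  · simp only [letterMulRight, letterMul_cons, List.getLast?_cons_cons, List.dropLast_cons_cons]
    split_ifs <;> rfl

theorem letterMulRight_add (a : α) (f g : List α → ℤ) :
    letterMulRight a (f + g) = letterMulRight a f + letterMulRight a g := by
  funext w
  simp only [letterMulRight, Pi.add_apply]
  split_ifs <;> simp

theorem magnusOp_letterMulRight (g : FreeGroup α) (a : α) (f : List α → ℤ) :
    magnusOp g (letterMulRight a f) = letterMulRight a (magnusOp g f) := by
  have hletter : ∀ (b : α) (f : List α → ℤ), (1 + letterMul b) (letterMulRight a f) =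
      letterMulRight a ((1 + letterMul b) f) := fun b f => by
    rw [LinearMap.add_apply, LinearMap.add_apply, letterMul_letterMulRight, letterMulRight_add]
    rfl
  refine magnusOp_induction (motive := fun T => ∀ f, T (letterMulRight a f) =
    letterMulRight a (T f)) (fun _ => rfl) hletter (fun b f => ?_) (fun S T hS hT f => ?_) g f
  · have h1 : ∀ f, oneAddLetterInv b ((1 + letterMul b) f) = f := fun f =>
      LinearMap.congr_fun (oneAddLetter b).inv_val f
    have h2 : ∀ f, (1 + letterMul b) (oneAddLetterInv b f) = f := fun f =>
      LinearMap.congr_fun (oneAddLetter b).val_inv f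
    rw [← h1 (letterMulRight a (oneAddLetterInv b f)), hletter, h2]
  · rw [Module.End.mul_apply, Module.End.mul_apply, hT, hS]

theorem letterMul_one (a : α) :
    letterMul a (Pi.single [] 1) = letterMulRight a (Pi.single [] 1) := by
  funext w
  rcases w with _ | ⟨c, _ | ⟨c', w⟩⟩
  · simp [letterMulRight, letterMul_nil]
  · simp [letterMulRight, letterMul_cons]
  · simp [letterMulRight, letterMul_cons]

/-- If an element of `P_n` commutes modulo `P_{n+2}` with all free generators, then it belongs to
`P_{n+1}`: the series `f = g - 1` satisfies `f a ≡ a f` modulo degree `n + 2` for each letter `a`,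
and for a word `w` whose first letter differs from `a`, the coefficient of `f a - a f` at `w a` is
the coefficient of `f` at `w`. -/
theorem mem_lowerPSeries_succ_of_commutator_mem [Finite α] [Nontrivial α] (hp : p.Prime) {n : ℕ}
    (hn : 1 ≤ n) {g : FreeGroup α} (hg : g ∈ lowerPSeries p (FreeGroup α) n)
    (h : ∀ a, ⁅g, FreeGroup.of a⁆ ∈ lowerPSeries p (FreeGroup α) (n + 2)) :
    g ∈ lowerPSeries p (FreeGroup α) (n + 1) := by
  refine mem_lowerPSeries_succ_of_magnusSeries_mem hp hn hg fun w => ?_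
  rcases w with _ | ⟨b, w⟩
  · rw [magnusSeries_nil]
    exact dvd_zero _
  obtain ⟨a, hab⟩ := exists_ne b
  have hop : magnusOp g * letterMul a - letterMul a * magnusOp g ∈ opFiltration α p (n + 2) := by
    have h1 := mul_mem_opFiltration (mem_congruenceSubgroup.1
      (lowerPSeries_le_congruenceSubgroup (by omega) (h a)))
      (magnusOp_mem_opFiltration (FreeGroup.of a * g))
    have e : (magnusOp ⁅g, FreeGroup.of a⁆ - 1) * magnusOp (FreeGroup.of a * g) =
        magnusOp g * letterMul a - letterMul a * magnusOp g := by
      rw [sub_mul, ← magnusOp_mul,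
        show ⁅g, FreeGroup.of a⁆ * (FreeGroup.of a * g) = g * FreeGroup.of a by
          simp [commutatorElement_def, mul_assoc],
        magnusOp_mul, one_mul, magnusOp_mul, magnusOp_of]
      noncomm_ring
    rwa [e] at h1
  have hcoef := hop _ _ single_nil_mem_seriesFiltration ((b :: w) ++ [a])
  rw [LinearMap.sub_apply, Module.End.mul_apply, Module.End.mul_apply, letterMul_one,
    magnusOp_letterMulRight, Pi.sub_apply, List.cons_append, letterMul_cons, if_neg hab.symm,
    sub_zero, ← List.cons_append, letterMulRight, if_pos List.getLast?_concat,
    List.dropLast_concat] at hcoef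
  have e : magnusSeries g (b :: w) = magnusOp g (Pi.single [] 1) (b :: w) := by
    simp [magnusSeries]
  rw [e]
  refine (pow_dvd_pow _ ?_).trans hcoef
  simp only [List.length_append, List.length_cons, List.length_nil]
  omega

theorem mem_lowerPSeries_iff_commutator_mem [Finite α] [Nontrivial α] (hp : p.Prime) {n : ℕ}
    (hn : 1 ≤ n) {g : FreeGroup α} : g ∈ lowerPSeries p (FreeGroup α) n ↔
      ∀ h, ⁅g, h⁆ ∈ lowerPSeries p (FreeGroup α) (n + 1) := by
  refine ⟨fun hg h => commutator_mem_lowerPSeries hn hg h, fun h => ?_⟩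
  suffices ∀ m, 1 ≤ m → m ≤ n → g ∈ lowerPSeries p (FreeGroup α) m from this n hn le_rfl
  intro m hm
  induction m, hm using Nat.le_induction with
  | base => exact fun _ => Subgroup.mem_top g
  | succ m hm ih =>
    intro hmn
    exact mem_lowerPSeries_succ_of_commutator_mem hp hm (ih (by omega)) fun a =>
      lowerPSeries_antitone (by omega) (h _)

end Center

/-! ### The series of quotient groups -/

section Quotient

variable {G H : Type*} [Group G] [Group H]

theorem map_powSubgroup (f : G →* H) (A : Subgroup G) (m : ℕ) :
    (powSubgroup A m).map f = powSubgroup (A.map f) m := by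
  rw [powSubgroup, MonoidHom.map_closure, powSubgroup]
  congr 1
  ext y
  constructor
  · rintro ⟨_, ⟨a, ha, rfl⟩, rfl⟩
    exact ⟨f a, Subgroup.mem_map_of_mem f ha, map_pow f a m⟩
  · rintro ⟨_, ⟨a, ha, rfl⟩, rfl⟩
    exact ⟨a ^ m, ⟨a, ha, rfl⟩, map_pow f a m⟩

theorem map_gammaSeries {f : G →* H} (hf : Function.Surjective f) (n : ℕ) :
    (gammaSeries G n).map f = gammaSeries H n := by
  rw [gammaSeries, Subgroup.map_lowerCentralSeries, Subgroup.map_top_of_surjective f hf,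
    gammaSeries]

theorem map_lambdaSeries (p : ℕ) {f : G →* H} (hf : Function.Surjective f) (n : ℕ) :
    (lambdaSeries p G n).map f = lambdaSeries p H n := by
  simp only [lambdaSeries, Subgroup.map_iSup, map_powSubgroup, map_gammaSeries hf]

theorem mk_mem_lambdaSeries_iff {p : ℕ} {N : Subgroup G} [N.Normal] {n : ℕ}
    (h : N ≤ lambdaSeries p G n) {g : G} :
    (g : G ⧸ N) ∈ lambdaSeries p (G ⧸ N) n ↔ g ∈ lambdaSeries p G n := by
  rw [← map_lambdaSeries p (QuotientGroup.mk'_surjective N), ← QuotientGroup.mk'_apply,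
    ← Subgroup.mem_comap, Subgroup.comap_map_eq, QuotientGroup.ker_mk', sup_eq_left.2 h]

theorem mem_upperCentralSeries_succ {i : ℕ} {g : G} :
    g ∈ Subgroup.upperCentralSeries G (i + 1) ↔
      ∀ h, ⁅g, h⁆ ∈ Subgroup.upperCentralSeries G i :=
  Iff.rfl

end Quotient

/-! ### The upper central series of the disposition group -/

theorem upperCentralSeries_dispositionGroup {p d c : ℕ} (hp : p.Prime) (hd : 2 ≤ d) {i : ℕ}
    (hi : i ≤ c) : Subgroup.upperCentralSeries (DispositionGroup p d c) i =
      lambdaSeries p (DispositionGroup p d c) (c - i + 1) := by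
  have : Nontrivial (Fin d) := Fin.nontrivial_iff_two_le.2 hd
  have hP : ∀ n, 1 ≤ n →
      lambdaSeries p (FreeGroup (Fin d)) n = lowerPSeries p (FreeGroup (Fin d)) n := fun n hn =>
    (lowerPSeries_eq_lambdaSeries FreeGroup.of (FreeGroup.closure_range_of _) hn).symm
  have hN : ∀ n, 1 ≤ n → n ≤ c + 1 → lambdaSeries p (FreeGroup (Fin d)) (c + 1) ≤
      lambdaSeries p (FreeGroup (Fin d)) n := fun n h1 h2 => by
    rw [hP _ h1, hP _ (by omega)]
    exact lowerPSeries_antitone h2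
  induction i with
  | zero =>
    rw [Subgroup.upperCentralSeries_zero, Nat.sub_zero,
      ← map_lambdaSeries p (QuotientGroup.mk'_surjective _), eq_comm, Subgroup.map_eq_bot_iff,
      QuotientGroup.ker_mk']
  | succ i ih =>
    ext y
    obtain ⟨g, rfl⟩ := QuotientGroup.mk_surjective y
    rw [mem_upperCentralSeries_succ, ih (by omega), mk_mem_lambdaSeries_iff
      (hN _ (by omega) (by omega)), hP (c - (i + 1) + 1) (by omega),
      mem_lowerPSeries_iff_commutator_mem hp (by omega),
      show c - (i + 1) + 1 + 1 = c - i + 1 by omega, ← hP (c - i + 1) (by omega)]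
    have key : ∀ h : FreeGroup (Fin d), ⁅(g : DispositionGroup p d c), (h : DispositionGroup p d c)⁆
        ∈ lambdaSeries p (DispositionGroup p d c) (c - i + 1) ↔
        ⁅g, h⁆ ∈ lambdaSeries p (FreeGroup (Fin d)) (c - i + 1) := fun h =>
      mk_mem_lambdaSeries_iff (g := ⁅g, h⁆) (hN _ (by omega) (by omega))
    refine ⟨fun hy h => (key h).1 (hy h), fun hg y => ?_⟩
    obtain ⟨h, rfl⟩ := QuotientGroup.mk_surjective y
    exact (key h).2 (hg h)

theorem mainTheorem4 (p d c : ℕ) (hp : p.Prime) (hd : 2 ≤ d) (hc : 2 ≤ c) :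
    (∀ i : ℕ, i ≤ c →
      Subgroup.upperCentralSeries (DispositionGroup p d c) i =
        lambdaSeries p (DispositionGroup p d c) (c - i + 1)) ∧
    (∀ i : ℕ, i < c →
      Subgroup.upperCentralSeries (DispositionGroup p d c) i ≤
        Subgroup.upperCentralSeries (DispositionGroup p d c) (i + 1)) ∧
    Subgroup.upperCentralSeries (DispositionGroup p d c) 0 = ⊥ ∧
    Subgroup.center (DispositionGroup p d c) = lambdaSeries p (DispositionGroup p d c) c ∧
    Subgroup.upperCentralSeries (DispositionGroup p d c) c =
      lambdaSeries p (DispositionGroup p d c) 1 ∧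
    lambdaSeries p (DispositionGroup p d c) 1 = ⊤ := by
  refine ⟨fun i hi => upperCentralSeries_dispositionGroup hp hd hi,
    fun i _ => Subgroup.upperCentralSeries_mono _ i.le_succ, Subgroup.upperCentralSeries_zero _,
    ?_, ?_, ?_⟩
  · rw [← Subgroup.upperCentralSeries_one, upperCentralSeries_dispositionGroup hp hd (by omega)]
    congr 1
    omega
  · rw [upperCentralSeries_dispositionGroup hp hd le_rfl, Nat.sub_self]
  · exact top_le_iff.1 (gammaSeries_le_lambdaSeries le_rfl)
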